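/- **Setting.** Let $(\Omega,\Sigma,\mu)$ be a measure space and $\mathcal A\subseteq\Sigma$ a sub-$\sigma$-algebra such that $\mu|_{\mathcal A}$ is $\sigma$-finite. Let $E=E^{\mathcal A}$ be the conditional expectation, defined for measurable $f\ge 0$ (with values in $[0,\infty]$) and for complex measurable $f$ with $E|f|<\infty$ a.e. A *Young function* is an even, convex, lower semicontinuous $\Phi:\mathbb R\to[0,\infty]$ with $\Phi(0)=0$ that is finite at some $x>0$ and is not identically $0$. Its complementary function is $\Psi(y)=\sup\{x|y|-\Phi(x):x\ge 0\}$, and we assume that $\Psi(y)=0$ only for $y=0$. For $\Theta\in\{\Phi,\Psi\}$ and $t\in[0,\infty]$ put $\Theta^{-1}(t)=\sup\{x\ge0:\Theta(x)\le t\}$. The Orlicz space $L^\Theta$ consists of the (classes of) measurable $f:\Omega\to\mathbb C$ with $\int_\Omega\Theta(k|f|)\,d\mu<\infty$ for some $k>0$; $L^\Phi$ carries the norm $N_\Phi(f)=\inf\{k>0:\int_\Omega\Phi(|f|/k)\,d\mu\le1\}$. * $\Phi\in\Delta'$ (globally) means: there is $c>0$ with $\Phi(xy)\le c\,\Phi(x)\Phi(y)$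 for all $x,y\ge0$ (with $0\cdot\infty=0$). * $\Psi\prec x$ (globally) means: there is $a\ge0$ with $\Psi(x)\le ax$ for all $x\ge0$. * $(E,\Phi)$ satisfies the *generalized conditional-type Hölder inequality* if there is a constant $C>0$ such that for all $f\in L^\Phi$, $g\in L^\Psi$, almost everywhere (with $0\cdot\infty=0$), $$E(|fg|)\le C\,\Phi^{-1}\big(E(\Phi(|f|))\big)\,\Psi^{-1}\big(E(\Psi(|g|))\big).$$ * An *$\mathcal A$-atom* is a set $A\in\mathcal A$ with $\mu(A)>0$ such that every $F\in\mathcal A$ with $F\subseteq A$ has $\mu(F)=0$ or $\mu(F)=\mu(A)$. A set *consists of finitely many $\mathcal A$-atoms* if, up to a $\mu$-null set, it is the union of a finite (possibly empty) family of $\mathcal A$-atoms. Let $u:\Omega\to\mathbb C$ be measurable and such that $EM_u:f\mapsto E(uf)$ is well defined on $L^\Phi$, i.e. $E(|uf|)<\infty$ a.e. for every $f\in L^\Phi$. That $EM_u$ is compact means that it maps $L^\Phi$ into $L^\Phi$ and is a compact operator on $(L^\Phi,N_\Phi)$. For $\varepsilon>0$ let $$N_\varepsilon=\{x\in\Omega:\Psi^{-1}(E(\Psi(|u|)))(x)\ge\varepsilon\}.$$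 **Corollary 2.4.** Assume that $(E,\Phi)$ satisfies the generalized conditional-type Hölder inequality. 1. If $\Phi\in\Delta'$ globally, or if $\Psi\prec x$ globally, then $EM_u$ is compact if and only if, for every $\varepsilon>0$, the set $N_\varepsilon$ consists of finitely many $\mathcal A$-atoms. 2. If $(\Omega,\mathcal A,\mu|_{\mathcal A})$ is non-atomic (there are no $\mathcal A$-atoms) and $\Phi\in\Delta'$ globally, then $EM_u$ is compact if and only if $EM_u=0$ on $L^\Phi$. -/

import Mathlib

open MeasureTheory Set
open scoped ENNReal NNReal

noncomputable section

/-- A Young function: an even, convex, lower semicontinuous function `Φ : ℝ → [0,∞]` with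
`Φ 0 = 0` that is finite at some positive point and nonzero at some point.  (Every finite-valued
convex function on `ℝ` is continuous, so the finite-valued Young functions are the continuous
even convex ones.  The value `∞` is allowed, so that pairs such as `L^∞`, `L^1` are covered.) -/
structure YoungFunction where
  toFun : ℝ → ℝ≥0∞
  convex' : ConvexOn ℝ≥0 univ toFun
  even' : ∀ x, toFun (-x) = toFun x
  zero' : toFun 0 = 0
  lsc' : LowerSemicontinuous toFun
  exists_ne_top' : ∃ x, 0 < x ∧ toFun x ≠ ∞
  exists_ne_zero' : ∃ x, toFun x ≠ 0

namespace YoungFunction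

instance : CoeFun YoungFunction fun _ => ℝ → ℝ≥0∞ := ⟨toFun⟩

/-- The complementary function `Ψ(y) = sup {x|y| - Φ(x) : x ≥ 0}`.  The subtraction in `[0,∞]` is
truncated at `0`, which does not change the supremum, as `x = 0` contributes `0`. -/
def complementary (Φ : YoungFunction) (y : ℝ) : ℝ≥0∞ :=
  ⨆ (x : ℝ) (_ : 0 ≤ x), ENNReal.ofReal (x * |y|) - Φ x

/-- The global `Δ'` condition: `Φ(xy) ≤ c Φ(x) Φ(y)` for all `x, y ≥ 0`. -/
def DeltaPrime (Φ : YoungFunction) : Prop :=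
  ∃ c : ℝ≥0, 0 < c ∧ ∀ x y : ℝ, 0 ≤ x → 0 ≤ y → Φ (x * y) ≤ c * Φ x * Φ y

lemma mul_le (Φ : YoungFunction) (x : ℝ) {t : ℝ} (ht : 0 ≤ t) (ht1 : t ≤ 1) :
    Φ (t * x) ≤ ENNReal.ofReal t * Φ x := by
  have h := Φ.convex'.2 (mem_univ x) (mem_univ (0 : ℝ)) zero_le
    zero_le (add_tsub_cancel_of_le (Real.toNNReal_le_one.2 ht1))
  simpa [Φ.zero', NNReal.smul_def, Real.coe_toNNReal t ht, ENNReal.smul_def,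
    ENNReal.ofReal] using h

lemma mono (Φ : YoungFunction) {x y : ℝ} (hx : 0 ≤ x) (hxy : x ≤ y) : Φ x ≤ Φ y := by
  rcases hx.eq_or_lt with rfl | hx
  · simp [Φ.zero']
  have hy := hx.trans_le hxy
  have h := Φ.mul_le y (t := x / y) (by positivity) ((div_le_one hy).2 hxy)
  rw [div_mul_cancel₀ _ hy.ne'] at h
  refine h.trans (mul_le_of_le_one_left zero_le ?_)
  exact ENNReal.ofReal_le_one.2 ((div_le_one hy).2 hxy)

lemma measurable (Φ : YoungFunction) : Measurable Φ := Φ.lsc'.measurable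

lemma convex_le (Φ : YoungFunction) (x y : ℝ) {s t : ℝ} (hs : 0 ≤ s) (ht : 0 ≤ t)
    (hst : s + t = 1) :
    Φ (s * x + t * y) ≤ ENNReal.ofReal s * Φ x + ENNReal.ofReal t * Φ y := by
  have h := Φ.convex'.2 (mem_univ x) (mem_univ y) zero_le
    zero_le (by rw [← Real.toNNReal_add hs ht, hst, Real.toNNReal_one])
  simpa [NNReal.smul_def, Real.coe_toNNReal s hs, Real.coe_toNNReal t ht, ENNReal.smul_def,
    ENNReal.ofReal] using h

end YoungFunction

/-- `Φ₂ ≺ Φ₁` globally: `Φ₂(x) ≤ Φ₁(a x)` for all `x ≥ 0`, for some constant `a ≥ 0`. -/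
def GloballyWeaker (Φ₂ Φ₁ : ℝ → ℝ≥0∞) : Prop :=
  ∃ a : ℝ, 0 ≤ a ∧ ∀ x : ℝ, 0 ≤ x → Φ₂ x ≤ Φ₁ (a * x)

/-- The inverse `y ↦ sup {x ≥ 0 : Φ(x) ≤ y}` on `[0,∞]` of a nondecreasing function on `[0,∞)`.
It is the ordinary inverse, extended by `∞ ↦ ∞`, when `Φ` is a bijection of `[0,∞)`. -/
def genInv (Φ : ℝ → ℝ≥0∞) (y : ℝ≥0∞) : ℝ≥0∞ :=
  ⨆ (x : ℝ) (_ : 0 ≤ x) (_ : Φ x ≤ y), ENNReal.ofReal x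

section Orlicz

variable {Ω : Type*} {mΩ : MeasurableSpace Ω}

/-- `f ∈ L^Φ(Ω, μ)`: `f` is measurable and `∫ Φ(k|f|) dμ < ∞` for some `k > 0`. -/
def MemOrlicz (Φ : ℝ → ℝ≥0∞) (f : Ω → ℂ) (μ : Measure Ω) : Prop :=
  AEStronglyMeasurable f μ ∧ ∃ k : ℝ, 0 < k ∧ ∫⁻ x, Φ (k * ‖f x‖) ∂μ < ∞

/-- The Luxemburg norm `N_Φ(f) = inf {k > 0 : ∫ Φ(|f|/k) dμ ≤ 1}`. -/
def luxemburgNorm (Φ : ℝ → ℝ≥0∞) (f : Ω → ℂ) (μ : Measure Ω) : ℝ :=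
  sInf {k : ℝ | 0 < k ∧ ∫⁻ x, Φ (‖f x‖ / k) ∂μ ≤ 1}

variable {μ : Measure Ω} (Φ : YoungFunction)

lemma luxemburg_set_upward {f : Ω → ℂ} {k l : ℝ} (hkl : k ≤ l)
    (hk : 0 < k ∧ ∫⁻ x, Φ (‖f x‖ / k) ∂μ ≤ 1) :
    0 < l ∧ ∫⁻ x, Φ (‖f x‖ / l) ∂μ ≤ 1 := by
  have hl := hk.1.trans_le hkl
  refine ⟨hl, (lintegral_mono fun x => Φ.mono (by positivity) ?_).trans hk.2⟩
  exact div_le_div_of_nonneg_left (norm_nonneg _) hk.1 hkl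

lemma luxemburg_set_nonempty {f : Ω → ℂ} (hf : MemOrlicz Φ f μ) :
    {k : ℝ | 0 < k ∧ ∫⁻ x, Φ (‖f x‖ / k) ∂μ ≤ 1}.Nonempty := by
  obtain ⟨-, k, hk, hI⟩ := hf
  set I := ∫⁻ x, Φ (k * ‖f x‖) ∂μ with hIdef
  set t : ℝ := 1 / (1 + I.toReal) with ht
  have hI0 : 0 ≤ I.toReal := ENNReal.toReal_nonneg
  have ht0 : 0 < t := by positivity
  have ht1 : t ≤ 1 := by rw [ht, div_le_one (by positivity)]; linarith
  refine ⟨1 / (t * k), by positivity, ?_⟩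
  have h1 : ∀ x, Φ (‖f x‖ / (1 / (t * k))) ≤ ENNReal.ofReal t * Φ (k * ‖f x‖) := fun x => by
    have : ‖f x‖ / (1 / (t * k)) = t * (k * ‖f x‖) := by field_simp
    rw [this]
    exact Φ.mul_le _ ht0.le ht1
  calc ∫⁻ x, Φ (‖f x‖ / (1 / (t * k))) ∂μ
      ≤ ∫⁻ x, ENNReal.ofReal t * Φ (k * ‖f x‖) ∂μ := lintegral_mono h1
    _ = ENNReal.ofReal t * I := lintegral_const_mul' _ _ ENNReal.ofReal_ne_top
    _ = ENNReal.ofReal (t * I.toReal) := by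
        rw [ENNReal.ofReal_mul ht0.le, ENNReal.ofReal_toReal hI.ne]
    _ ≤ 1 := by
        rw [ENNReal.ofReal_le_one, ht, div_mul_eq_mul_div, div_le_one (by positivity)]
        linarith

lemma luxemburg_set_add {f g : Ω → ℂ} (hf : AEStronglyMeasurable f μ) {k l : ℝ}
    (hk : 0 < k ∧ ∫⁻ x, Φ (‖f x‖ / k) ∂μ ≤ 1) (hl : 0 < l ∧ ∫⁻ x, Φ (‖g x‖ / l) ∂μ ≤ 1) :
    0 < k + l ∧ ∫⁻ x, Φ (‖f x + g x‖ / (k + l)) ∂μ ≤ 1 := by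
  have hk0 := hk.1
  have hl0 := hl.1
  have hkl : 0 < k + l := add_pos hk0 hl0
  refine ⟨hkl, ?_⟩
  have hst : k / (k + l) + l / (k + l) = 1 := by field_simp
  have h1 : ∀ x, Φ (‖f x + g x‖ / (k + l)) ≤
      ENNReal.ofReal (k / (k + l)) * Φ (‖f x‖ / k) +
        ENNReal.ofReal (l / (k + l)) * Φ (‖g x‖ / l) := fun x => by
    refine (Φ.mono (by positivity) ?_).trans
      (Φ.convex_le (‖f x‖ / k) (‖g x‖ / l) (by positivity) (by positivity) hst)
    have : k / (k + l) * (‖f x‖ / k) + l / (k + l) * (‖g x‖ / l)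
        = (‖f x‖ + ‖g x‖) / (k + l) := by field_simp
    rw [this]
    exact div_le_div_of_nonneg_right (norm_add_le _ _) hkl.le
  have hm : AEMeasurable (fun x => Φ (‖f x‖ / k)) μ :=
    Φ.measurable.comp_aemeasurable (hf.norm.aemeasurable.div_const k)
  calc ∫⁻ x, Φ (‖f x + g x‖ / (k + l)) ∂μ
      ≤ ∫⁻ x, (ENNReal.ofReal (k / (k + l)) * Φ (‖f x‖ / k) +
        ENNReal.ofReal (l / (k + l)) * Φ (‖g x‖ / l)) ∂μ := lintegral_mono h1
    _ = ENNReal.ofReal (k / (k + l)) * ∫⁻ x, Φ (‖f x‖ / k) ∂μ +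
        ENNReal.ofReal (l / (k + l)) * ∫⁻ x, Φ (‖g x‖ / l) ∂μ := by
        rw [lintegral_add_left' (hm.const_mul _), lintegral_const_mul' _ _ ENNReal.ofReal_ne_top,
          lintegral_const_mul' _ _ ENNReal.ofReal_ne_top]
    _ ≤ ENNReal.ofReal (k / (k + l)) * 1 + ENNReal.ofReal (l / (k + l)) * 1 := by
        gcongr
        · exact hk.2
        · exact hl.2
    _ = 1 := by
        rw [mul_one, mul_one, ← ENNReal.ofReal_add (by positivity) (by positivity), hst,
          ENNReal.ofReal_one]

lemma luxemburg_set_smul {f : Ω → ℂ} {c : ℂ} (hc : c ≠ 0) {k : ℝ}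
    (hk : 0 < k ∧ ∫⁻ x, Φ (‖f x‖ / k) ∂μ ≤ 1) :
    0 < ‖c‖ * k ∧ ∫⁻ x, Φ (‖c * f x‖ / (‖c‖ * k)) ∂μ ≤ 1 := by
  have hc' : 0 < ‖c‖ := norm_pos_iff.2 hc
  refine ⟨mul_pos hc' hk.1, ?_⟩
  simpa only [norm_mul, mul_div_mul_left _ _ hc'.ne'] using hk.2

lemma luxemburgNorm_nonneg (f : Ω → ℂ) : 0 ≤ luxemburgNorm Φ f μ :=
  Real.sInf_nonneg fun _ hk => hk.1.le

lemma luxemburgNorm_congr {f g : Ω → ℂ} (h : f =ᵐ[μ] g) :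
    luxemburgNorm Φ f μ = luxemburgNorm Φ g μ := by
  have : ∀ k : ℝ, ∫⁻ x, Φ (‖f x‖ / k) ∂μ = ∫⁻ x, Φ (‖g x‖ / k) ∂μ := fun k =>
    lintegral_congr_ae (h.mono fun x hx => by simp only [hx])
  simp only [luxemburgNorm, this]

lemma MemOrlicz.of_ae_eq {f g : Ω → ℂ} (hf : MemOrlicz Φ f μ) (h : f =ᵐ[μ] g) :
    MemOrlicz Φ g μ := by
  obtain ⟨hm, k, hk, hI⟩ := hf
  refine ⟨hm.congr h, k, hk, ?_⟩
  have : ∫⁻ x, Φ (k * ‖f x‖) ∂μ = ∫⁻ x, Φ (k * ‖g x‖) ∂μ :=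
    lintegral_congr_ae (h.mono fun x hx => by simp only [hx])
  rwa [← this]

lemma memOrlicz_of_set {f : Ω → ℂ} (hf : AEStronglyMeasurable f μ) {k : ℝ}
    (hk : 0 < k ∧ ∫⁻ x, Φ (‖f x‖ / k) ∂μ ≤ 1) : MemOrlicz Φ f μ := by
  refine ⟨hf, 1 / k, one_div_pos.2 hk.1, lt_of_le_of_lt ?_ ENNReal.one_lt_top⟩
  simpa only [one_div, inv_mul_eq_div] using hk.2

lemma MemOrlicz.add {f g : Ω → ℂ} (hf : MemOrlicz Φ f μ) (hg : MemOrlicz Φ g μ) :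
    MemOrlicz Φ (f + g) μ := by
  obtain ⟨k, hk⟩ := luxemburg_set_nonempty Φ hf
  obtain ⟨l, hl⟩ := luxemburg_set_nonempty Φ hg
  exact memOrlicz_of_set Φ (hf.1.add hg.1) (luxemburg_set_add Φ hf.1 hk hl)

lemma memOrlicz_zero : MemOrlicz Φ (0 : Ω → ℂ) μ :=
  ⟨aestronglyMeasurable_zero, 1, one_pos, by simp [Φ.zero']⟩

lemma MemOrlicz.const_smul {f : Ω → ℂ} (hf : MemOrlicz Φ f μ) (c : ℂ) :
    MemOrlicz Φ (c • f) μ := by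
  rcases eq_or_ne c 0 with rfl | hc
  · rw [zero_smul]; exact memOrlicz_zero Φ
  obtain ⟨k, hk⟩ := luxemburg_set_nonempty Φ hf
  exact memOrlicz_of_set Φ (hf.1.const_smul c) (luxemburg_set_smul Φ hc hk)

lemma luxemburgNorm_add_le {f g : Ω → ℂ} (hf : MemOrlicz Φ f μ) (hg : MemOrlicz Φ g μ) :
    luxemburgNorm Φ (f + g) μ ≤ luxemburgNorm Φ f μ + luxemburgNorm Φ g μ := by
  refine le_of_forall_pos_le_add fun ε hε => ?_
  obtain ⟨k, hk, hk'⟩ := exists_lt_of_csInf_lt (luxemburg_set_nonempty Φ hf)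
    (lt_add_of_pos_right (luxemburgNorm Φ f μ) (half_pos hε))
  obtain ⟨l, hl, hl'⟩ := exists_lt_of_csInf_lt (luxemburg_set_nonempty Φ hg)
    (lt_add_of_pos_right (luxemburgNorm Φ g μ) (half_pos hε))
  have : luxemburgNorm Φ (f + g) μ ≤ k + l :=
    csInf_le ⟨0, fun _ h => h.1.le⟩ (luxemburg_set_add Φ hf.1 hk hl)
  linarith

lemma luxemburgNorm_smul_le {f : Ω → ℂ} (hf : MemOrlicz Φ f μ) {c : ℂ} (hc : c ≠ 0) :
    luxemburgNorm Φ (c • f) μ ≤ ‖c‖ * luxemburgNorm Φ f μ := by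
  have hc' : 0 < ‖c‖ := norm_pos_iff.2 hc
  rw [← div_le_iff₀' hc']
  refine le_csInf (luxemburg_set_nonempty Φ hf) fun k hk => ?_
  rw [div_le_iff₀' hc']
  exact csInf_le ⟨0, fun _ h => h.1.le⟩ (luxemburg_set_smul Φ hc hk)

lemma luxemburgNorm_zero : luxemburgNorm Φ (0 : Ω → ℂ) μ = 0 := by
  refine le_antisymm (le_of_forall_pos_le_add fun ε hε => ?_) (luxemburgNorm_nonneg Φ _)
  rw [zero_add]
  exact csInf_le ⟨0, fun _ h => h.1.le⟩ ⟨hε, by simp [Φ.zero']⟩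

lemma luxemburgNorm_smul {f : Ω → ℂ} (hf : MemOrlicz Φ f μ) (c : ℂ) :
    luxemburgNorm Φ (c • f) μ = ‖c‖ * luxemburgNorm Φ f μ := by
  rcases eq_or_ne c 0 with rfl | hc
  · rw [zero_smul, luxemburgNorm_zero, norm_zero, zero_mul]
  refine le_antisymm (luxemburgNorm_smul_le Φ hf hc) ?_
  have h := luxemburgNorm_smul_le Φ (hf.const_smul Φ c) (inv_ne_zero hc)
  rwa [inv_smul_smul₀ hc, norm_inv, ← div_eq_inv_mul, le_div_iff₀' (norm_pos_iff.2 hc)] at h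

lemma ae_eq_zero_of_luxemburgNorm_eq_zero {f : Ω → ℂ} (hf : MemOrlicz Φ f μ)
    (h : luxemburgNorm Φ f μ = 0) : f =ᵐ[μ] 0 := by
  have hall : ∀ k : ℝ, 0 < k → ∫⁻ x, Φ (‖f x‖ / k) ∂μ ≤ 1 := fun k hk => by
    obtain ⟨l, hl, hlk⟩ := exists_lt_of_csInf_lt (luxemburg_set_nonempty Φ hf)
      (show luxemburgNorm Φ f μ < k by rwa [h])
    exact (luxemburg_set_upward Φ hlk.le hl).2
  have hzero : ∀ n : ℕ, ∀ᵐ x ∂μ, Φ ((n + 1 : ℝ) * ‖f x‖) = 0 := fun n => by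
    have hm : AEMeasurable (fun x => Φ ((n + 1 : ℝ) * ‖f x‖)) μ :=
      Φ.measurable.comp_aemeasurable (hf.1.norm.aemeasurable.const_mul _)
    refine (lintegral_eq_zero_iff' hm).1 (le_antisymm ?_ zero_le)
    refine ENNReal.le_of_forall_pos_le_add fun ε hε _ => ?_
    rw [zero_add]
    set t : ℝ := min (ε : ℝ) 1
    have ht0 : 0 < t := lt_min hε one_pos
    have h1 : ∀ x, Φ ((n + 1 : ℝ) * ‖f x‖) ≤
        ENNReal.ofReal t * Φ (‖f x‖ / (t / (n + 1))) := fun x => by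
      have : (n + 1 : ℝ) * ‖f x‖ = t * (‖f x‖ / (t / (n + 1))) := by field_simp
      rw [this]
      exact Φ.mul_le _ ht0.le (min_le_right _ _)
    calc ∫⁻ x, Φ ((n + 1 : ℝ) * ‖f x‖) ∂μ
        ≤ ∫⁻ x, ENNReal.ofReal t * Φ (‖f x‖ / (t / (n + 1))) ∂μ := lintegral_mono h1
      _ = ENNReal.ofReal t * ∫⁻ x, Φ (‖f x‖ / (t / (n + 1))) ∂μ :=
          lintegral_const_mul' _ _ ENNReal.ofReal_ne_top
      _ ≤ ENNReal.ofReal t * 1 := by gcongr; exact hall _ (by positivity)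
      _ ≤ ε := by
          rw [mul_one]
          exact ENNReal.ofReal_le_of_le_toReal (min_le_left _ _)
  obtain ⟨x₀, hx₀⟩ := Φ.exists_ne_zero'
  filter_upwards [ae_all_iff.2 hzero] with x hx
  by_contra hne
  have hpos : 0 < ‖f x‖ := norm_pos_iff.2 hne
  obtain ⟨n, hn⟩ := exists_nat_ge (|x₀| / ‖f x‖)
  rw [div_le_iff₀ hpos] at hn
  have h2 : Φ |x₀| = 0 := le_antisymm
    ((Φ.mono (abs_nonneg _) (by nlinarith)).trans (hx n).le) zero_le
  apply hx₀
  rcases abs_choice x₀ with h3 | h3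
  · rwa [h3] at h2
  · rwa [h3, Φ.even'] at h2

/-- The linear subspace `L^Φ(Ω, μ)` of the space of a.e.-classes of measurable functions. -/
def orliczSubmodule (Φ : YoungFunction) (μ : Measure Ω) : Submodule ℂ (Ω →ₘ[μ] ℂ) where
  carrier := {f | MemOrlicz Φ f μ}
  add_mem' {f g} hf hg := (MemOrlicz.add Φ hf hg).of_ae_eq Φ (AEEqFun.coeFn_add f g).symm
  zero_mem' := (memOrlicz_zero Φ).of_ae_eq Φ AEEqFun.coeFn_zero.symm
  smul_mem' c f hf := (MemOrlicz.const_smul Φ hf c).of_ae_eq Φ (AEEqFun.coeFn_smul c f).symm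

/-- The Orlicz space `L^Φ(Ω, μ)`. -/
def OrliczSpace (Φ : YoungFunction) (μ : Measure Ω) : Type _ := orliczSubmodule Φ μ

namespace OrliczSpace

instance : AddCommGroup (OrliczSpace Φ μ) := inferInstanceAs (AddCommGroup (orliczSubmodule Φ μ))

instance : Module ℂ (OrliczSpace Φ μ) := inferInstanceAs (Module ℂ (orliczSubmodule Φ μ))

instance : CoeFun (OrliczSpace Φ μ) fun _ => Ω → ℂ := ⟨fun f => (f.1 : Ω → ℂ)⟩

instance : Norm (OrliczSpace Φ μ) := ⟨fun f => luxemburgNorm Φ f μ⟩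

lemma normedSpaceCore : NormedSpace.Core ℂ (OrliczSpace Φ μ) where
  norm_nonneg f := luxemburgNorm_nonneg Φ _
  norm_smul c f :=
    (luxemburgNorm_congr Φ (AEEqFun.coeFn_smul c f.1)).trans (luxemburgNorm_smul Φ f.2 c)
  norm_triangle f g :=
    (luxemburgNorm_congr Φ (AEEqFun.coeFn_add f.1 g.1)).trans_le
      (luxemburgNorm_add_le Φ f.2 g.2)
  norm_eq_zero_iff f := by
    constructor
    · intro h
      have := ae_eq_zero_of_luxemburgNorm_eq_zero Φ f.2 h
      exact Subtype.ext (AEEqFun.ext (this.trans AEEqFun.coeFn_zero.symm))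
    · rintro rfl
      exact (luxemburgNorm_congr Φ AEEqFun.coeFn_zero).trans (luxemburgNorm_zero Φ)

instance : NormedAddCommGroup (OrliczSpace Φ μ) := NormedAddCommGroup.ofCore (normedSpaceCore Φ)

instance : NormedSpace ℂ (OrliczSpace Φ μ) := NormedSpace.ofCore (normedSpaceCore Φ)

end OrliczSpace

end Orlicz

section ConditionalExpectation

variable {Ω : Type*} {mΩ : MeasurableSpace Ω}

/-- The conditional expectation `E^𝓐 h` of a complex function with `E^𝓐|h| < ∞` a.e., obtained
from the conditional expectation `condLExp` of `[0,∞]`-valued functions applied to the positive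
and negative parts of the real and imaginary parts of `h`. -/
def condExpC (𝓐 : MeasurableSpace Ω) (μ : Measure[mΩ] Ω) (h : Ω → ℂ) (x : Ω) : ℂ where
  re := (condLExp 𝓐 μ (fun y => ENNReal.ofReal (h y).re) x).toReal -
    (condLExp 𝓐 μ (fun y => ENNReal.ofReal (-(h y).re)) x).toReal
  im := (condLExp 𝓐 μ (fun y => ENNReal.ofReal (h y).im) x).toReal -
    (condLExp 𝓐 μ (fun y => ENNReal.ofReal (-(h y).im)) x).toReal

/-- The operator `E M_u : f ↦ E^𝓐(u f)`. -/
def EM (𝓐 : MeasurableSpace Ω) (μ : Measure[mΩ] Ω) (u f : Ω → ℂ) : Ω → ℂ :=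
  condExpC 𝓐 μ (fun x => u x * f x)

/-- `E M_u` is well defined on `L^Φ`: `E^𝓐|u f| < ∞` a.e. for every `f ∈ L^Φ`, so that `E^𝓐(u f)`
is an a.e. finite function. -/
def EMWellDefined (𝓐 : MeasurableSpace Ω) (μ : Measure[mΩ] Ω) (Φ : YoungFunction)
    (u : Ω → ℂ) : Prop :=
  ∀ f : Ω → ℂ, MemOrlicz Φ f μ → ∀ᵐ x ∂μ, condLExp 𝓐 μ (fun y => ‖u y * f y‖ₑ) x < ∞

/-- `E M_u` is a compact operator on the normed space `L^Φ`. -/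
def EMCompact (𝓐 : MeasurableSpace Ω) (μ : Measure[mΩ] Ω) (Φ : YoungFunction)
    (u : Ω → ℂ) : Prop :=
  ∃ T : OrliczSpace Φ μ →L[ℂ] OrliczSpace Φ μ,
    (∀ f : OrliczSpace Φ μ, (T f : Ω → ℂ) =ᵐ[μ] EM 𝓐 μ u f) ∧ IsCompactOperator T

/-- `E M_u = 0` on `L^Φ`. -/
def EMZero (𝓐 : MeasurableSpace Ω) (μ : Measure[mΩ] Ω) (Φ : YoungFunction) (u : Ω → ℂ) : Prop :=
  ∀ f : OrliczSpace Φ μ, EM 𝓐 μ u f =ᵐ[μ] 0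

/-- The generalized conditional-type Hölder inequality for `(E^𝓐, Φ)`. -/
def GenCondHolder (𝓐 : MeasurableSpace Ω) (μ : Measure[mΩ] Ω) (Φ : YoungFunction) : Prop :=
  ∃ C : ℝ≥0, 0 < C ∧ ∀ f g : Ω → ℂ, MemOrlicz Φ f μ → MemOrlicz Φ.complementary g μ →
    ∀ᵐ x ∂μ, condLExp 𝓐 μ (fun y => ‖f y * g y‖ₑ) x ≤
      C * genInv Φ (condLExp 𝓐 μ (fun y => Φ ‖f y‖) x) *
        genInv Φ.complementary (condLExp 𝓐 μ (fun y => Φ.complementary ‖g y‖) x)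

/-- `A` is an `𝓐`-atom of `μ`. -/
def IsAtomOf (𝓐 : MeasurableSpace Ω) (μ : Measure[mΩ] Ω) (A : Set Ω) : Prop :=
  MeasurableSet[𝓐] A ∧ 0 < μ A ∧
    ∀ F : Set Ω, MeasurableSet[𝓐] F → F ⊆ A → μ F = 0 ∨ μ F = μ A

/-- `S` consists of finitely many (possibly zero) `𝓐`-atoms, up to a null set. -/
def FinitelyManyAtoms (𝓐 : MeasurableSpace Ω) (μ : Measure[mΩ] Ω) (S : Set Ω) : Prop :=
  ∃ F : Set (Set Ω), F.Finite ∧ (∀ A ∈ F, IsAtomOf 𝓐 μ A) ∧ S =ᵐ[μ] ⋃₀ F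

/-- The level set `N_ε(Ψ⁻¹(E^𝓐(Ψ(|u|)))) = {x : Ψ⁻¹(E^𝓐(Ψ(|u|)))(x) ≥ ε}`. -/
def levelSet (𝓐 : MeasurableSpace Ω) (μ : Measure[mΩ] Ω) (Ψ : ℝ → ℝ≥0∞) (u : Ω → ℂ)
    (ε : ℝ) : Set Ω :=
  {x | ENNReal.ofReal ε ≤ genInv Ψ (condLExp 𝓐 μ (fun y => Ψ ‖u y‖) x)}

end ConditionalExpectation

end

open MeasureTheory Set
open scoped ENNReal NNReal

/-! Write Ψ for the complementary function and N_ε for the level sets.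

Sufficiency: EM_u is an operator-norm limit of compact operators. Off N_ε the Hölder inequality
gives E|uf| ≤ Cε Φ⁻¹(E Φ(|f|)) (`condLExp_mul_le_off_levelSet`). Hence Φ(|E(uf)|/(2Cε)) ≤ E Φ(|f|),
and integration bounds the norm of the part of EM_u off N_ε by 2Cε (`exists_clm_off_levelSet`). On
an atom A every conditional expectation is constant, so the part of EM_u on A has rank at most one,
with coefficient functional f ↦ (μ A)⁻¹ ∫_A uf. That functional is bounded by a gliding-hump
argument (`exists_bound_setLIntegral_mul`). So the part on N_ε has finite rank
(`exists_compact_on_sUnion`), and ε → 0 gives compactness, the space being complete.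

Necessity: a level set that is not a finite union of atoms contains infinitely many disjoint
non-null 𝓐-sets (`exists_disjoint_seq_of_not_finitelyManyAtoms`). Inside each one lies a set B of
finite positive measure carrying a function f of norm at most c with |E(uf)| ≥ δr on B, where r =
Φ⁻¹(1/μ B). Since r · 1_B has norm about 1, the images of these functions are δ-separated, which
contradicts compactness (`finitelyManyAtoms_of_EMCompact`).

The two alternative growth conditions serve only to construct f. If Ψ(x) ≤ ax, then E|u| ≥ E
Ψ(|u|)/a is bounded below on the level set, so r · 1_B corrected by the phase of u is enough. Under
Δ', take s(|u|) nearly extremal in Young's inequality and divide it by 1 + E Φ(s(|u|)). This keeps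
E(|u|f) large, and Δ' splits Φ(rh) into cΦ(r)Φ(h), which controls the modular.

Without atoms every level set is null. Then E Ψ(|u|) = 0, and u = 0 because Ψ vanishes only at 0. -/

noncomputable section

/-! ### Young functions, their complements and generalized inverses -/

section YoungLemmas

namespace YoungFunction

variable (Φ : YoungFunction)

lemma complementary_mono {y z : ℝ} (h : |y| ≤ |z|) : Φ.complementary y ≤ Φ.complementary z := by
  refine iSup₂_mono fun x hx => ?_
  gcongr

lemma complementary_zero : Φ.complementary 0 = 0 := by
  simp [complementary]

lemma le_complementary {x : ℝ} (hx : 0 ≤ x) (y : ℝ) :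
    ENNReal.ofReal (x * |y|) - Φ x ≤ Φ.complementary y :=
  le_iSup₂ (f := fun (x : ℝ) (_ : 0 ≤ x) => ENNReal.ofReal (x * |y|) - Φ x) x hx

/-- An enumeration of the nonnegative rationals. -/
def nnratSeq : ℕ → ℚ≥0 := (exists_surjective_nat ℚ≥0).choose

lemma nnratSeq_surjective : Function.Surjective nnratSeq := (exists_surjective_nat ℚ≥0).choose_spec

/-- A real x can be replaced by a rational q slightly below it: q|y| is continuous in q, while Φ(q)
≤ Φ(x) by monotonicity, so continuity of Φ is not needed. The countable form yields measurability
and monotone approximation of Ψ. -/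
lemma complementary_eq_iSup (y : ℝ) :
    Φ.complementary y = ⨆ n, (ENNReal.ofReal ((nnratSeq n : ℝ) * |y|) - Φ (nnratSeq n)) := by
  refine le_antisymm (iSup₂_le fun x hx => ?_)
    (iSup_le fun n => Φ.le_complementary (by positivity) y)
  rcases hx.eq_or_lt with rfl | hx
  · simp
  rw [tsub_le_iff_right]
  refine le_of_forall_lt fun c hc => ?_
  have hcont : Filter.Tendsto (fun t : ℝ => ENNReal.ofReal (t * |y|)) (nhdsWithin x (Iio x))
      (nhds (ENNReal.ofReal (x * |y|))) :=
    (ENNReal.continuous_ofReal.comp (continuous_id.mul continuous_const)).continuousWithinAt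
  have h1 := (hcont.eventually (lt_mem_nhds hc)).and
    (Ioo_mem_nhdsLT hx : Ioo (0 : ℝ) x ∈ nhdsWithin x (Iio x))
  obtain ⟨a, ha, hax⟩ := (mem_nhdsLT_iff_exists_Ioo_subset (a := x)).1 h1
  obtain ⟨q, hq1, hq2⟩ := exists_rat_btwn (mem_Iio.1 ha)
  obtain ⟨hq3, hq0, -⟩ := hax ⟨hq1, hq2⟩
  have hq0' : (0 : ℚ) ≤ q := by exact_mod_cast hq0.le
  obtain ⟨n, hn⟩ := nnratSeq_surjective ⟨q, hq0'⟩
  have hcast : ((nnratSeq n : ℚ≥0) : ℝ) = (q : ℝ) := by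
    rw [hn]; rfl
  have h2 := le_iSup (fun n => ENNReal.ofReal ((nnratSeq n : ℝ) * |y|) - Φ (nnratSeq n)) n
  simp only [hcast] at h2
  rw [tsub_le_iff_right] at h2
  refine hq3.trans_le (h2.trans ?_)
  gcongr
  exact Φ.mono hq0.le hq2.le

lemma measurable_complementary : Measurable Φ.complementary := by
  have : Φ.complementary =
      fun y => ⨆ n, (ENNReal.ofReal ((nnratSeq n : ℝ) * |y|) - Φ (nnratSeq n)) :=
    funext Φ.complementary_eq_iSup
  rw [this]
  refine Measurable.iSup fun n => ?_
  exact (((continuous_const.mul continuous_abs).measurable).ennreal_ofReal).sub_const _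

lemma exists_pos_le {η : ℝ≥0∞} (hη : 0 < η) : ∃ x : ℝ, 0 < x ∧ Φ x ≤ η := by
  obtain ⟨x, hx, hx'⟩ := Φ.exists_ne_top'
  have h1 : Filter.Tendsto (fun t : ℝ => ENNReal.ofReal t * Φ x) (nhdsWithin 0 (Ioi 0))
      (nhds (ENNReal.ofReal 0 * Φ x)) :=
    ENNReal.Tendsto.mul_const (ENNReal.continuous_ofReal.continuousWithinAt) (Or.inr hx')
  rw [ENNReal.ofReal_zero, zero_mul] at h1
  obtain ⟨t, ht, ht0, ht1⟩ := ((h1.eventually (gt_mem_nhds hη)).and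
    (Ioo_mem_nhdsGT (zero_lt_one (α := ℝ)))).exists
  exact ⟨t * x, by positivity, (Φ.mul_le x ht0.le ht1.le).trans ht.le⟩

lemma exists_pos_ne_zero : ∃ x : ℝ, 0 < x ∧ Φ x ≠ 0 := by
  obtain ⟨x, hx⟩ := Φ.exists_ne_zero'
  have h0 : x ≠ 0 := fun h => hx (h ▸ Φ.zero')
  rcases abs_choice x with h | h
  · exact ⟨|x|, abs_pos.2 h0, by rwa [h]⟩
  · exact ⟨|x|, abs_pos.2 h0, by rwa [h, Φ.even']⟩

/-- Convexity and Φ(0) = 0 give Φ(tx) ≥ tΦ(x) for t ≥ 1, so a single nonzero value makes Φ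
unbounded. -/
lemma exists_lt {s : ℝ≥0∞} (hs : s ≠ ∞) : ∃ x : ℝ, 0 < x ∧ s < Φ x := by
  obtain ⟨x, hx, hx'⟩ := Φ.exists_pos_ne_zero
  obtain ⟨t, ht1, ht⟩ : ∃ t : ℝ, 1 < t ∧ s < ENNReal.ofReal t * Φ x := by
    have h1 : Filter.Tendsto (fun t : ℝ => ENNReal.ofReal t * Φ x) Filter.atTop
        (nhds (∞ * Φ x)) :=
      ENNReal.Tendsto.mul_const ENNReal.tendsto_ofReal_atTop (Or.inl ENNReal.top_ne_zero)
    rw [ENNReal.top_mul hx'] at h1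
    exact ((Filter.eventually_gt_atTop 1).and
      (h1.eventually (lt_mem_nhds hs.lt_top))).exists
  have ht0 : 0 < t := one_pos.trans ht1
  refine ⟨t * x, by positivity, ht.trans_le ?_⟩
  have h2 := Φ.mul_le (t * x) (t := t⁻¹) (by positivity) (inv_le_one_of_one_le₀ ht1.le)
  rw [inv_mul_cancel_left₀ ht0.ne'] at h2
  calc ENNReal.ofReal t * Φ x ≤ ENNReal.ofReal t * (ENNReal.ofReal t⁻¹ * Φ (t * x)) := by gcongr
    _ = Φ (t * x) := by
      rw [← mul_assoc, ← ENNReal.ofReal_mul ht0.le, mul_inv_cancel₀ ht0.ne', ENNReal.ofReal_one,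
        one_mul]

/-- The sublevel set of Φ in [0,∞) is closed by lower semicontinuity and bounded because Φ is
unbounded. The supremum is therefore attained, even where Φ jumps to ∞. -/
lemma genInv_spec {s : ℝ≥0∞} (hs : s ≠ ∞) : ∃ r : ℝ, 0 ≤ r ∧ genInv Φ s = ENNReal.ofReal r ∧
    Φ r ≤ s ∧ (∀ x, r < x → s < Φ x) ∧ (0 < s → 0 < r) := by
  obtain ⟨b, hb, hb'⟩ := Φ.exists_lt hs
  set S : Set ℝ := {x | 0 ≤ x ∧ Φ x ≤ s} with hS
  have hS0 : (0 : ℝ) ∈ S := ⟨le_rfl, by simp [Φ.zero']⟩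
  have hSb : BddAbove S := ⟨b, fun x hx => by
    by_contra! h
    exact absurd (hb'.trans_le (Φ.mono hb.le h.le)) (not_lt.2 hx.2)⟩
  have hScl : IsClosed S := isClosed_Ici.inter (Φ.lsc'.isClosed_preimage s)
  have hmem : sSup S ∈ S := hScl.csSup_mem ⟨0, hS0⟩ hSb
  refine ⟨sSup S, hmem.1, ?_, hmem.2, fun x hx => ?_, fun h0 => ?_⟩
  · refine le_antisymm (iSup_le fun x => iSup₂_le fun hx hx' => ?_) ?_
    · exact ENNReal.ofReal_le_ofReal (le_csSup hSb ⟨hx, hx'⟩)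
    · exact le_iSup_of_le (sSup S) (le_iSup₂_of_le hmem.1 hmem.2 le_rfl)
  · by_contra! h
    exact absurd (le_csSup hSb ⟨hmem.1.trans hx.le, h⟩) (not_le.2 hx)
  · obtain ⟨x, hx, hx'⟩ := Φ.exists_pos_le h0
    exact hx.trans_le (le_csSup hSb ⟨hx.le, hx'⟩)

lemma exists_pos_complementary_le {η : ℝ≥0∞} (hη : 0 < η) :
    ∃ y : ℝ, 0 < y ∧ Φ.complementary y ≤ η := by
  obtain ⟨x, hx, hx'⟩ := Φ.exists_pos_ne_zero
  obtain ⟨b, hb, hbη⟩ : ∃ b : ℝ, 0 < b ∧ ENNReal.ofReal b ≤ η := by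
    rcases eq_or_ne η ∞ with rfl | h
    · exact ⟨1, one_pos, le_top⟩
    · exact ⟨η.toReal, ENNReal.toReal_pos hη.ne' h, ENNReal.ofReal_toReal_le⟩
  obtain ⟨c, hc, hcx⟩ : ∃ c : ℝ, 0 < c ∧ ENNReal.ofReal c ≤ Φ x := by
    rcases eq_or_ne (Φ x) ∞ with h | h
    · exact ⟨1, one_pos, h ▸ le_top⟩
    · exact ⟨(Φ x).toReal, ENNReal.toReal_pos hx' h, ENNReal.ofReal_toReal_le⟩
  -- With c ≤ Φ(x), convexity keeps the line t ↦ tc/x below Φ for t ≥ x, so the difference is 0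
  -- there. For t ≤ x, the slope b/x keeps ty below b ≤ η.
  refine ⟨min (b / x) (c / x), by positivity, iSup₂_le fun t ht => ?_⟩
  rw [abs_of_pos (by positivity), tsub_le_iff_right]
  rcases le_total t x with htx | htx
  · refine le_add_right (le_trans (ENNReal.ofReal_le_ofReal ?_) hbη)
    calc t * min (b / x) (c / x) ≤ x * (b / x) := by gcongr; exact min_le_left _ _
      _ = b := by field_simp
  · refine le_add_left ?_
    have ht0 := hx.trans_le htx
    have h2 := Φ.mul_le t (t := x / t) (by positivity) ((div_le_one ht0).2 htx)
    rw [div_mul_cancel₀ _ ht0.ne'] at h2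
    calc ENNReal.ofReal (t * min (b / x) (c / x)) ≤ ENNReal.ofReal (t / x * c) := by
          refine ENNReal.ofReal_le_ofReal ?_
          calc t * min (b / x) (c / x) ≤ t * (c / x) := by gcongr; exact min_le_right _ _
            _ = t / x * c := by field_simp
      _ = ENNReal.ofReal (t / x) * ENNReal.ofReal c := ENNReal.ofReal_mul (by positivity)
      _ ≤ ENNReal.ofReal (t / x) * (ENNReal.ofReal (x / t) * Φ t) := by
          gcongr; exact hcx.trans h2
      _ = Φ t := by
          rw [← mul_assoc, ← ENNReal.ofReal_mul (by positivity)]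
          have : t / x * (x / t) = 1 := by field_simp
          rw [this, ENNReal.ofReal_one, one_mul]

/-- The partial suprema of `complementary_eq_iSup`. -/
def complementaryApprox (n : ℕ) (y : ℝ) : ℝ≥0∞ :=
  ⨆ i : Fin n, (ENNReal.ofReal ((nnratSeq i : ℝ) * |y|) - Φ (nnratSeq i))

lemma measurable_complementaryApprox (n : ℕ) : Measurable (Φ.complementaryApprox n) := by
  refine Measurable.iSup fun i => ?_
  exact (((continuous_const.mul continuous_abs).measurable).ennreal_ofReal).sub_const _

lemma complementaryApprox_mono (y : ℝ) : Monotone fun n => Φ.complementaryApprox n y := by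
  intro m n hmn
  exact iSup_le fun i => le_iSup_of_le (Fin.castLE hmn i) le_rfl

lemma iSup_complementaryApprox (y : ℝ) :
    ⨆ n, Φ.complementaryApprox n y = Φ.complementary y := by
  rw [complementary_eq_iSup]
  refine le_antisymm (iSup_le fun n => iSup_le fun i => le_iSup_of_le i.1 le_rfl)
    (iSup_le fun n => le_iSup_of_le (n + 1) (le_iSup_of_le (Fin.last n) le_rfl))

lemma complementaryApprox_succ (n : ℕ) (y : ℝ) : Φ.complementaryApprox (n + 1) y =
    max (Φ.complementaryApprox n y)
      (ENNReal.ofReal ((nnratSeq n : ℝ) * |y|) - Φ (nnratSeq n)) := by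
  refine le_antisymm (iSup_le fun i => ?_) (max_le (Φ.complementaryApprox_mono y n.le_succ)
    (le_iSup_of_le (Fin.last n) le_rfl))
  rcases (Nat.lt_succ_iff_lt_or_eq.1 i.2) with h | h
  · exact le_max_of_le_left (le_iSup_of_le (⟨i.1, h⟩ : Fin n) le_rfl)
  · rw [h]; exact le_max_right _ _

/-- A bounded measurable selection attaining equality in Young's inequality for the partial
suprema of the complementary function. -/
lemma exists_young_selection (n : ℕ) : ∃ (h : ℝ → ℝ) (M : ℝ≥0∞), Measurable h ∧ M ≠ ∞ ∧
    ∀ y, 0 ≤ y → 0 ≤ h y ∧ Φ (h y) ≤ M ∧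
      Φ.complementaryApprox n y + Φ (h y) ≤ ENNReal.ofReal (y * h y) := by
  induction n with
  | zero =>
    refine ⟨fun _ => 0, 0, measurable_const, ENNReal.zero_ne_top, fun y hy => ?_⟩
    simp [complementaryApprox, Φ.zero']
  | succ n ih =>
    obtain ⟨h, M, hm, hM, hh⟩ := ih
    -- A rational with Φ = ∞ contributes 0 by truncated subtraction, so the previous selection still
    -- works.
    rcases eq_or_ne (Φ (nnratSeq n)) ∞ with hq | hq
    · refine ⟨h, M, hm, hM, fun y hy => ?_⟩
      obtain ⟨h1, h2, h3⟩ := hh y hy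
      refine ⟨h1, h2, ?_⟩
      simpa [complementaryApprox_succ, hq] using h3
    classical
    -- The selection switches to the new rational only where it strictly increases the supremum.
    -- There the subtraction is not truncated, so Young's inequality becomes an equality.
    set S : Set ℝ := {y | Φ.complementaryApprox n y <
      ENNReal.ofReal ((nnratSeq n : ℝ) * |y|) - Φ (nnratSeq n)} with hS
    have hSm : MeasurableSet S := measurableSet_lt (Φ.measurable_complementaryApprox n)
      ((((continuous_const.mul continuous_abs).measurable).ennreal_ofReal).sub_const _)
    refine ⟨S.piecewise (fun _ => (nnratSeq n : ℝ)) h, max M (Φ (nnratSeq n)),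
      Measurable.piecewise hSm measurable_const hm, by simp [hM, hq], fun y hy => ?_⟩
    obtain ⟨h1, h2, h3⟩ := hh y hy
    by_cases hyS : y ∈ S
    · rw [piecewise_eq_of_mem _ _ _ hyS]
      refine ⟨by positivity, le_max_right _ _, ?_⟩
      have hlt : Φ.complementaryApprox n y <
        ENNReal.ofReal ((nnratSeq n : ℝ) * |y|) - Φ (nnratSeq n) := hyS
      have hle : Φ (nnratSeq n) ≤ ENNReal.ofReal ((nnratSeq n : ℝ) * |y|) :=
        (tsub_pos_iff_lt.1 (zero_le.trans_lt hlt)).le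
      rw [complementaryApprox_succ, max_eq_right hlt.le, tsub_add_cancel_of_le hle,
        abs_of_nonneg hy, mul_comm]
    · rw [piecewise_eq_of_notMem _ _ _ hyS]
      refine ⟨h1, h2.trans (le_max_left _ _), ?_⟩
      rwa [complementaryApprox_succ, max_eq_left (not_lt.1 hyS)]

end YoungFunction

lemma genInv_mono (Φ : ℝ → ℝ≥0∞) : Monotone (genInv Φ) := fun _ _ hst =>
  iSup_mono fun _ => iSup_mono fun _ => iSup_le fun h => le_iSup_of_le (h.trans hst) le_rfl

lemma measurable_genInv (Φ : ℝ → ℝ≥0∞) : Measurable (genInv Φ) := (genInv_mono Φ).measurable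

lemma genInv_top (Φ : ℝ → ℝ≥0∞) : genInv Φ ∞ = ∞ := by
  refine ENNReal.eq_top_of_forall_nnreal_le fun r => ?_
  exact le_iSup_of_le (r : ℝ) (le_iSup₂_of_le r.2 le_top (by simp))

/-- The inverse is a supremum that is not known here to be attained. Halving ε makes monotonicity of
Ψ sufficient. -/
lemma YoungFunction.complementary_half_le (Φ : YoungFunction) {ε : ℝ} (hε : 0 < ε) {t : ℝ≥0∞}
    (h : ENNReal.ofReal ε ≤ genInv Φ.complementary t) : Φ.complementary (ε / 2) ≤ t := by
  by_contra! hlt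
  have : genInv Φ.complementary t ≤ ENNReal.ofReal (ε / 2) := by
    refine iSup_le fun x => iSup₂_le fun hx hx' => ENNReal.ofReal_le_ofReal ?_
    by_contra! h2
    exact absurd (hx'.trans_lt hlt) (not_lt.2 (Φ.complementary_mono
      (by rw [abs_of_pos (half_pos hε), abs_of_nonneg hx]; exact h2.le)))
  have h3 := h.trans this
  rw [ENNReal.ofReal_le_ofReal_iff (by positivity)] at h3
  linarith

lemma YoungFunction.le_genInv_complementary (Φ : YoungFunction) {t : ℝ≥0∞} (ht : t ≠ 0) :
    ∃ ε : ℝ, 0 < ε ∧ ENNReal.ofReal ε ≤ genInv Φ.complementary t := by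
  obtain ⟨y, hy, hy'⟩ := Φ.exists_pos_complementary_le (pos_iff_ne_zero.2 ht)
  exact ⟨y, hy, le_iSup_of_le y (le_iSup₂_of_le hy.le hy' le_rfl)⟩

end YoungLemmas

/-! ### Conditional expectation: pull-out, linearity, locality, values on atoms -/

section ConditionalExpectationLemmas

variable {Ω : Type*} {𝓐 mΩ : MeasurableSpace Ω} {μ : Measure[mΩ] Ω}

/-- The pull-out property of the conditional Lebesgue expectation. -/
lemma condLExp_mul_left (h𝓐 : 𝓐 ≤ mΩ) [SigmaFinite (μ.trim h𝓐)]
    {w X : Ω → ℝ≥0∞} (hw : Measurable[𝓐] w) (hX : AEMeasurable X μ) :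
    condLExp 𝓐 μ (fun x => w x * X x) =ᵐ[μ] fun x => w x * condLExp 𝓐 μ X x := by
  symm
  refine ae_eq_condLExp h𝓐 μ _ (hw.mul (measurable_condLExp 𝓐 μ X)) fun s hs => ?_
  have hE : Measurable (condLExp 𝓐 μ X) := measurable_condLExp' 𝓐 μ X
  have hw' : Measurable w := hw.mono h𝓐 le_rfl
  -- X and E(X) are densities of the same measure on 𝓐. Integrating the 𝓐-measurable w against that
  -- measure gives the claim with no finiteness assumption.
  have key : (μ.withDensity (condLExp 𝓐 μ X)).trim h𝓐 = (μ.withDensity X).trim h𝓐 := by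
    refine @Measure.ext Ω 𝓐 _ _ fun t ht => ?_
    rw [trim_measurableSet_eq h𝓐 ht, trim_measurableSet_eq h𝓐 ht,
      withDensity_apply _ (h𝓐 t ht), withDensity_apply _ (h𝓐 t ht),
      setLIntegral_condLExp h𝓐 μ X ht]
  have hind : ∀ Y : Ω → ℝ≥0∞, AEMeasurable Y μ →
      ∫⁻ x in s, w x * Y x ∂μ = ∫⁻ x, s.indicator w x ∂((μ.withDensity Y).trim h𝓐) := by
    intro Y hY
    rw [lintegral_trim h𝓐 (hw.indicator hs), ← lintegral_indicator (h𝓐 s hs),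
      lintegral_withDensity_eq_lintegral_mul₀ hY ((hw'.indicator (h𝓐 s hs)).aemeasurable)]
    refine lintegral_congr fun x => ?_
    by_cases hx : x ∈ s <;> simp [hx, mul_comm]
  rw [hind _ hE.aemeasurable, hind _ hX, key]

lemma condLExp_indicator (h𝓐 : 𝓐 ≤ mΩ) [SigmaFinite (μ.trim h𝓐)]
    {A : Set Ω} (hA : MeasurableSet[𝓐] A) {X : Ω → ℝ≥0∞}
    (hX : AEMeasurable X μ) :
    condLExp 𝓐 μ (A.indicator X) =ᵐ[μ] A.indicator (condLExp 𝓐 μ X) := by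
  have h := condLExp_mul_left h𝓐 (w := A.indicator fun _ => 1) (measurable_const.indicator hA) hX
  have h1 : ∀ Y : Ω → ℝ≥0∞, (fun x => A.indicator (fun _ => 1) x * Y x) = A.indicator Y := by
    intro Y; ext x; by_cases hx : x ∈ A <;> simp [hx]
  rwa [h1, h1] at h

/-- The conditional expectation of a real function, as a difference of those of the positive and
negative parts. -/
def condExpR (𝓐 : MeasurableSpace Ω) (μ : Measure[mΩ] Ω) (f : Ω → ℝ) (x : Ω) : ℝ :=
  (condLExp 𝓐 μ (fun y => ENNReal.ofReal (f y)) x).toReal -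
    (condLExp 𝓐 μ (fun y => ENNReal.ofReal (-f y)) x).toReal

lemma condExpC_eq (h : Ω → ℂ) (x : Ω) : condExpC 𝓐 μ h x =
    ⟨condExpR 𝓐 μ (fun y => (h y).re) x, condExpR 𝓐 μ (fun y => (h y).im) x⟩ := rfl

/-- From f⁺ + h = f⁻ + g in [0,∞], additivity of the conditional Lebesgue expectation gives the same
identity for the expectations, and finiteness allows subtraction. Additivity of the signed
expectation rests on this independence of the decomposition. -/
lemma condExpR_of_sub {f : Ω → ℝ} {g h : Ω → ℝ≥0∞} (hf : AEMeasurable f μ)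
    (hgt : ∀ x, g x ≠ ∞) (hht : ∀ x, h x ≠ ∞) (hfgh : ∀ x, f x = (g x).toReal - (h x).toReal)
    (hEg : ∀ᵐ x ∂μ, condLExp 𝓐 μ g x < ∞) (hEh : ∀ᵐ x ∂μ, condLExp 𝓐 μ h x < ∞) :
    condExpR 𝓐 μ f =ᵐ[μ]
      fun x => (condLExp 𝓐 μ g x).toReal - (condLExp 𝓐 μ h x).toReal := by
  have hp : AEMeasurable (fun x => ENNReal.ofReal (f x)) μ := hf.ennreal_ofReal
  have hn : AEMeasurable (fun x => ENNReal.ofReal (-f x)) μ := hf.neg.ennreal_ofReal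
  have hsum : ((fun x => ENNReal.ofReal (f x)) + h) = ((fun x => ENNReal.ofReal (-f x)) + g) := by
    ext x
    simp only [Pi.add_apply]
    have h1 := hfgh x
    rw [← ENNReal.ofReal_toReal (hgt x), ← ENNReal.ofReal_toReal (hht x)]
    have hg0 : 0 ≤ (g x).toReal := ENNReal.toReal_nonneg
    have hh0 : 0 ≤ (h x).toReal := ENNReal.toReal_nonneg
    rcases le_total 0 (f x) with h0 | h0
    · rw [ENNReal.ofReal_of_nonpos (neg_nonpos.2 h0), zero_add, ← ENNReal.ofReal_add h0 hh0]
      congr 1; linarith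
    · rw [ENNReal.ofReal_of_nonpos h0, zero_add, ← ENNReal.ofReal_add (neg_nonneg.2 h0) hg0]
      congr 1; linarith
  have hle1 : (fun x => ENNReal.ofReal (f x)) ≤ g := fun x => by
    have h1 := hfgh x
    have hh0 : 0 ≤ (h x).toReal := ENNReal.toReal_nonneg
    exact (ENNReal.ofReal_le_iff_le_toReal (hgt x)).2 (by linarith)
  have hle2 : (fun x => ENNReal.ofReal (-f x)) ≤ h := fun x => by
    have h1 := hfgh x
    have hh0 : 0 ≤ (g x).toReal := ENNReal.toReal_nonneg
    exact (ENNReal.ofReal_le_iff_le_toReal (hht x)).2 (by linarith)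
  have e1 := condLExp_add_left (mΩ := 𝓐) h hp
  have e2 := condLExp_add_left (mΩ := 𝓐) g hn
  rw [hsum] at e1
  filter_upwards [e1, e2, condLExp_mono (mΩ := 𝓐) (ae_of_all μ hle1),
    condLExp_mono (mΩ := 𝓐) (ae_of_all μ hle2), hEg, hEh] with x h1 h2 h3 h4 h5 h6
  rw [h1] at h2
  simp only [Pi.add_apply] at h2
  have h7 := congrArg ENNReal.toReal h2
  rw [ENNReal.toReal_add (h3.trans_lt h5).ne h6.ne, ENNReal.toReal_add (h4.trans_lt h6).ne h5.ne]
    at h7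
  simp only [condExpR]
  linarith

lemma ofReal_abs_eq (a : ℝ) : ENNReal.ofReal a ≤ ‖a‖ₑ ∧ ENNReal.ofReal (-a) ≤ ‖a‖ₑ := by
  rw [Real.enorm_eq_ofReal_abs]
  exact ⟨ENNReal.ofReal_le_ofReal (le_abs_self a), ENNReal.ofReal_le_ofReal (neg_le_abs a)⟩

lemma condLExp_ofReal_lt_top {f : Ω → ℝ} {F : Ω → ℝ≥0∞} (hF : ∀ x, ‖f x‖ₑ ≤ F x)
    (hE : ∀ᵐ x ∂μ, condLExp 𝓐 μ F x < ∞) :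
    (∀ᵐ x ∂μ, condLExp 𝓐 μ (fun y => ENNReal.ofReal (f y)) x < ∞) ∧
      ∀ᵐ x ∂μ, condLExp 𝓐 μ (fun y => ENNReal.ofReal (-f y)) x < ∞ := by
  constructor
  · filter_upwards [hE, condLExp_mono (mΩ := 𝓐) (ae_of_all μ fun x =>
      (ofReal_abs_eq (f x)).1.trans (hF x))] with x h1 h2 using h2.trans_lt h1
  · filter_upwards [hE, condLExp_mono (mΩ := 𝓐) (ae_of_all μ fun x =>
      (ofReal_abs_eq (f x)).2.trans (hF x))] with x h1 h2 using h2.trans_lt h1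

lemma condExpR_add {f g : Ω → ℝ} {F G : Ω → ℝ≥0∞} (hf : AEMeasurable f μ) (hg : AEMeasurable g μ)
    (hF : ∀ x, ‖f x‖ₑ ≤ F x) (hEF : ∀ᵐ x ∂μ, condLExp 𝓐 μ F x < ∞)
    (hG : ∀ x, ‖g x‖ₑ ≤ G x) (hEG : ∀ᵐ x ∂μ, condLExp 𝓐 μ G x < ∞) :
    condExpR 𝓐 μ (fun x => f x + g x) =ᵐ[μ] fun x => condExpR 𝓐 μ f x + condExpR 𝓐 μ g x := by
  have hf1 := hf.ennreal_ofReal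
  have hf2 : AEMeasurable (fun x => ENNReal.ofReal (-f x)) μ := hf.neg.ennreal_ofReal
  have hg1 := hg.ennreal_ofReal
  obtain ⟨a1, a2⟩ := condLExp_ofReal_lt_top hF hEF
  obtain ⟨b1, b2⟩ := condLExp_ofReal_lt_top hG hEG
  have e1 := condLExp_add_left (mΩ := 𝓐) (fun x => ENNReal.ofReal (g x)) hf1
  have e2 := condLExp_add_left (mΩ := 𝓐) (fun x => ENNReal.ofReal (-g x)) hf2
  have key := condExpR_of_sub (𝓐 := 𝓐) (hf.add hg)
    (g := (fun x => ENNReal.ofReal (f x)) + fun x => ENNReal.ofReal (g x))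
    (h := (fun x => ENNReal.ofReal (-f x)) + fun x => ENNReal.ofReal (-g x))
    (fun x => by simp) (fun x => by simp) (fun x => ?_) ?_ ?_
  · filter_upwards [key, e1, e2, a1, a2, b1, b2] with x h1 h2 h3 h4 h5 h6 h7
    refine h1.trans ?_
    rw [h2, h3]
    simp only [Pi.add_apply, condExpR]
    rw [ENNReal.toReal_add h4.ne h6.ne, ENNReal.toReal_add h5.ne h7.ne]
    ring
  · simp only [Pi.add_apply]
    rw [ENNReal.toReal_add (by simp) (by simp), ENNReal.toReal_add (by simp) (by simp),
      ENNReal.toReal_ofReal', ENNReal.toReal_ofReal', ENNReal.toReal_ofReal',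
      ENNReal.toReal_ofReal']
    have h1 := max_zero_sub_max_neg_zero_eq_self (f x)
    have h2 := max_zero_sub_max_neg_zero_eq_self (g x)
    linarith
  · filter_upwards [e1, a1, b1] with x h1 h2 h3
    exact h1.trans_lt (ENNReal.add_lt_top.2 ⟨h2, h3⟩)
  · filter_upwards [e2, a2, b2] with x h1 h2 h3
    exact h1.trans_lt (ENNReal.add_lt_top.2 ⟨h2, h3⟩)

lemma condExpR_const_mul {f : Ω → ℝ} {F : Ω → ℝ≥0∞} (hf : AEMeasurable f μ) (c : ℝ)
    (hF : ∀ x, ‖f x‖ₑ ≤ F x) (hEF : ∀ᵐ x ∂μ, condLExp 𝓐 μ F x < ∞) :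
    condExpR 𝓐 μ (fun x => c * f x) =ᵐ[μ] fun x => c * condExpR 𝓐 μ f x := by
  have hf1 := hf.ennreal_ofReal
  have hf2 := hf.neg.ennreal_ofReal
  obtain ⟨a1, a2⟩ := condLExp_ofReal_lt_top hF hEF
  rcases le_total 0 c with hc | hc
  · have e1 := condLExp_smul (mΩ := 𝓐) _ hf1 (ENNReal.ofReal c)
    have e2 := condLExp_smul (mΩ := 𝓐) _ hf2 (ENNReal.ofReal c)
    filter_upwards [e1, e2] with x h1 h2
    have g1 : (fun y => ENNReal.ofReal (c * f y)) =
        ENNReal.ofReal c • fun y => ENNReal.ofReal (f y) := by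
      ext y; simp [ENNReal.ofReal_mul hc]
    have g2 : (fun y => ENNReal.ofReal (-(c * f y))) =
        ENNReal.ofReal c • fun y => ENNReal.ofReal ((-f) y) := by
      ext y; simp [← mul_neg, ENNReal.ofReal_mul hc]
    simp only [condExpR, g1, g2]
    rw [h1, h2]
    simp only [Pi.smul_apply, smul_eq_mul, ENNReal.toReal_mul, ENNReal.toReal_ofReal hc]
    simp only [Pi.neg_apply]
    ring
  -- For c ≤ 0 the positive and negative parts change places.
  · have hc' : 0 ≤ -c := neg_nonneg.2 hc
    have e1 := condLExp_smul (mΩ := 𝓐) _ hf1 (ENNReal.ofReal (-c))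
    have e2 := condLExp_smul (mΩ := 𝓐) _ hf2 (ENNReal.ofReal (-c))
    filter_upwards [e1, e2] with x h1 h2
    have g1 : (fun y => ENNReal.ofReal (-(c * f y))) =
        ENNReal.ofReal (-c) • fun y => ENNReal.ofReal (f y) := by
      ext y; simp [← neg_mul, ENNReal.ofReal_mul hc']
    have g2 : (fun y => ENNReal.ofReal (c * f y)) =
        ENNReal.ofReal (-c) • fun y => ENNReal.ofReal ((-f) y) := by
      ext y; simp [← ENNReal.ofReal_mul hc']
    simp only [condExpR, g1, g2]
    rw [h1, h2]
    simp only [Pi.smul_apply, smul_eq_mul, ENNReal.toReal_mul, ENNReal.toReal_ofReal hc']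
    simp only [Pi.neg_apply]
    ring

lemma enorm_re_le (z : ℂ) : ‖z.re‖ₑ ≤ ‖z‖ₑ :=
  enorm_le_iff_norm_le.2 (by simpa using Complex.abs_re_le_norm z)

lemma enorm_im_le (z : ℂ) : ‖z.im‖ₑ ≤ ‖z‖ₑ :=
  enorm_le_iff_norm_le.2 (by simpa using Complex.abs_im_le_norm z)

lemma condExpC_add {f g : Ω → ℂ} (hf : AEMeasurable f μ) (hg : AEMeasurable g μ)
    (hEf : ∀ᵐ x ∂μ, condLExp 𝓐 μ (fun y => ‖f y‖ₑ) x < ∞)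
    (hEg : ∀ᵐ x ∂μ, condLExp 𝓐 μ (fun y => ‖g y‖ₑ) x < ∞) :
    condExpC 𝓐 μ (fun x => f x + g x) =ᵐ[μ] fun x => condExpC 𝓐 μ f x + condExpC 𝓐 μ g x := by
  filter_upwards [condExpR_add (Complex.measurable_re.comp_aemeasurable hf)
      (Complex.measurable_re.comp_aemeasurable hg) (fun x => enorm_re_le _) hEf
      (fun x => enorm_re_le _) hEg,
    condExpR_add (Complex.measurable_im.comp_aemeasurable hf)
      (Complex.measurable_im.comp_aemeasurable hg) (fun x => enorm_im_le _) hEf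
      (fun x => enorm_im_le _) hEg] with x h1 h2
  exact Complex.ext h1 h2

lemma condExpC_const_mul {f : Ω → ℂ} (hf : AEMeasurable f μ) (c : ℂ)
    (hEf : ∀ᵐ x ∂μ, condLExp 𝓐 μ (fun y => ‖f y‖ₑ) x < ∞) :
    condExpC 𝓐 μ (fun x => c * f x) =ᵐ[μ] fun x => c * condExpC 𝓐 μ f x := by
  have hr := Complex.measurable_re.comp_aemeasurable hf
  have hi := Complex.measurable_im.comp_aemeasurable hf
  have hle : ∀ (a : ℝ) (g : Ω → ℝ), (∀ x, ‖g x‖ₑ ≤ ‖f x‖ₑ) →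
      ∀ x, ‖a * g x‖ₑ ≤ (‖a‖ₑ • fun x => ‖f x‖ₑ) x := by
    intro a g hg x
    rw [enorm_mul, Pi.smul_apply, smul_eq_mul]
    gcongr
    exact hg x
  have hE : ∀ a : ℝ, ∀ᵐ x ∂μ, condLExp 𝓐 μ (‖a‖ₑ • fun x => ‖f x‖ₑ) x < ∞ := fun a => by
    filter_upwards [hEf, condLExp_smul (mΩ := 𝓐) _ hf.enorm ‖a‖ₑ] with x h1 h2
    rw [h2]
    exact ENNReal.mul_lt_top (by simp) h1
  have hre : ∀ x, ‖(f x).re‖ₑ ≤ ‖f x‖ₑ := fun x => enorm_re_le _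
  have him : ∀ x, ‖(f x).im‖ₑ ≤ ‖f x‖ₑ := fun x => enorm_im_le _
  filter_upwards [condExpR_const_mul hr c.re hre hEf, condExpR_const_mul hr c.im hre hEf,
    condExpR_const_mul hi c.re him hEf, condExpR_const_mul hi (-c.im) him hEf,
    condExpR_add (hr.const_mul c.re) (hi.const_mul (-c.im)) (hle c.re _ hre) (hE _)
      (hle (-c.im) _ him) (hE _),
    condExpR_add (hi.const_mul c.re) (hr.const_mul c.im) (hle c.re _ him) (hE _)
      (hle c.im _ hre) (hE _)] with x h1 h2 h3 h4 h5 h6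
  refine Complex.ext ?_ ?_
  · simp only [condExpC_eq, Complex.mul_re, Complex.mul_im]
    simp only [Function.comp_apply] at h1 h2 h3 h4 h5 h6
    rw [h1, h4] at h5
    simp only [neg_mul, ← sub_eq_add_neg] at h5
    exact h5
  · simp only [condExpC_eq, Complex.mul_re, Complex.mul_im]
    simp only [Function.comp_apply] at h1 h2 h3 h4 h5 h6
    rw [h3, h2] at h6
    exact h6

/-- Real and imaginary parts are estimated separately, which costs the factor 2. It is harmless,
since it only enters the constant 2Cε. -/
lemma enorm_condExpC_le (h : Ω → ℂ) :
    ∀ᵐ x ∂μ, ‖condExpC 𝓐 μ h x‖ₑ ≤ 2 * condLExp 𝓐 μ (fun y => ‖h y‖ₑ) x := by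
  have hm : ∀ g : Ω → ℝ, (∀ x, ‖g x‖ₑ ≤ ‖h x‖ₑ) →
      ∀ᵐ x ∂μ, ‖condExpR 𝓐 μ g x‖ₑ ≤ condLExp 𝓐 μ (fun y => ‖h y‖ₑ) x := by
    intro g hg
    filter_upwards [condLExp_mono (mΩ := 𝓐) (ae_of_all μ fun x =>
      (ofReal_abs_eq (g x)).1.trans (hg x)), condLExp_mono (mΩ := 𝓐) (ae_of_all μ fun x =>
      (ofReal_abs_eq (g x)).2.trans (hg x))] with x h1 h2
    rcases eq_or_ne (condLExp 𝓐 μ (fun y => ‖h y‖ₑ) x) ∞ with htop | htop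
    · rw [htop]; exact le_top
    rw [Real.enorm_eq_ofReal_abs]
    refine (ENNReal.ofReal_le_iff_le_toReal htop).2 (abs_le.2 ?_)
    have h3 := ENNReal.toReal_mono htop h1
    have h4 := ENNReal.toReal_mono htop h2
    have h5 : 0 ≤ (condLExp 𝓐 μ (fun y => ENNReal.ofReal (g y)) x).toReal :=
      ENNReal.toReal_nonneg
    have h6 : 0 ≤ (condLExp 𝓐 μ (fun y => ENNReal.ofReal (-g y)) x).toReal :=
      ENNReal.toReal_nonneg
    simp only [condExpR]
    constructor <;> linarith
  filter_upwards [hm _ fun x => enorm_re_le (h x), hm _ fun x => enorm_im_le (h x)] with x h1 h2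
  have h3 : ‖condExpC 𝓐 μ h x‖ₑ ≤ ‖condExpR 𝓐 μ (fun y => (h y).re) x‖ₑ +
      ‖condExpR 𝓐 μ (fun y => (h y).im) x‖ₑ := by
    rw [Real.enorm_eq_ofReal_abs, Real.enorm_eq_ofReal_abs,
      ← ENNReal.ofReal_add (abs_nonneg _) (abs_nonneg _), ← ofReal_norm]
    exact ENNReal.ofReal_le_ofReal (Complex.norm_le_abs_re_add_abs_im _)
  rw [two_mul]
  exact h3.trans (add_le_add h1 h2)

lemma condExpC_ofReal {g : Ω → ℝ} (hg : ∀ x, 0 ≤ g x) (x : Ω) :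
    condExpC 𝓐 μ (fun y => (g y : ℂ)) x =
      ((condLExp 𝓐 μ (fun y => ENNReal.ofReal (g y)) x).toReal : ℂ) := by
  have h0 : condLExp 𝓐 μ (fun _ => (0 : ℝ≥0∞)) x = 0 := congrFun (condLExp_zero μ) x
  have h1 : (fun y => ENNReal.ofReal (-g y)) = fun _ => 0 :=
    funext fun y => ENNReal.ofReal_of_nonpos (neg_nonpos.2 (hg y))
  refine Complex.ext ?_ ?_
  · simp [condExpC, h1, h0]
  · simp [condExpC, h0]

lemma measurable_condExpC (h : Ω → ℂ) : Measurable[𝓐] (condExpC 𝓐 μ h) := by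
  have h1 : ∀ g : Ω → ℝ, Measurable[𝓐] (condExpR 𝓐 μ g) := fun g =>
    ((measurable_condLExp 𝓐 μ _).ennreal_toReal).sub (measurable_condLExp 𝓐 μ _).ennreal_toReal
  exact Complex.measurableEquivRealProd.symm.measurable.comp ((h1 _).prodMk (h1 _))

/-- Locality: it makes the image of one test function vanish on the support of another. -/
lemma condExpC_eq_zero (h𝓐 : 𝓐 ≤ mΩ) [SigmaFinite (μ.trim h𝓐)]
    {h : Ω → ℂ} (hh : AEMeasurable h μ) {A : Set Ω} (hA : MeasurableSet[𝓐] A)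
    (h0 : ∀ x ∈ A, h x = 0) : ∀ᵐ x ∂μ, x ∈ A → condExpC 𝓐 μ h x = 0 := by
  have h1 : A.indicator (fun y => ‖h y‖ₑ) = 0 := by
    ext x
    by_cases hx : x ∈ A <;> simp [hx, h0]
  filter_upwards [enorm_condExpC_le (𝓐 := 𝓐) h, condLExp_indicator h𝓐 hA hh.enorm] with x h2 h3 hx
  rw [h1, condLExp_zero, indicator_of_mem hx] at h3
  rw [← h3] at h2
  simpa using h2

/-- By σ-finiteness a non-null A meets some spanning set in a non-null set, which then has the full
measure of A. Null A are admitted, so that differences of atoms are covered. -/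
lemma measure_lt_top_of_zero_one (h𝓐 : 𝓐 ≤ mΩ) [SigmaFinite (μ.trim h𝓐)]
    {A : Set Ω} (hA : MeasurableSet[𝓐] A)
    (h01 : ∀ F : Set Ω, MeasurableSet[𝓐] F → F ⊆ A → μ F = 0 ∨ μ F = μ A) : μ A < ∞ := by
  set S := spanningSets (μ.trim h𝓐)
  have hS : ∀ n, MeasurableSet[𝓐] (S n) := fun n => measurableSet_spanningSets _ n
  by_cases h : ∀ n, μ (A ∩ S n) = 0
  · have h1 : μ A = 0 := by
      rw [← inter_univ A, ← iUnion_spanningSets (μ.trim h𝓐), inter_iUnion]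
      exact measure_iUnion_null h
    rw [h1]; exact ENNReal.zero_lt_top
  · push Not at h
    obtain ⟨n, hn⟩ := h
    rw [← (h01 _ (hA.inter (hS n)) inter_subset_left).resolve_left hn]
    refine (measure_mono inter_subset_right).trans_lt ?_
    rw [← trim_measurableSet_eq h𝓐 (hS n)]
    exact measure_spanningSets_lt_top _ n

/-- An 𝓐-measurable function is almost everywhere constant on a set whose 𝓐-subsets are null or of
full measure. Integrating over A identifies the constant. -/
lemma condLExp_eq_on_atom (h𝓐 : 𝓐 ≤ mΩ) [SigmaFinite (μ.trim h𝓐)]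
    {A : Set Ω} (hA : MeasurableSet[𝓐] A)
    (h01 : ∀ F : Set Ω, MeasurableSet[𝓐] F → F ⊆ A → μ F = 0 ∨ μ F = μ A) (X : Ω → ℝ≥0∞) :
    ∀ᵐ x ∂μ, x ∈ A → condLExp 𝓐 μ X x = (μ A)⁻¹ * ∫⁻ y in A, X y ∂μ := by
  have hfin := measure_lt_top_of_zero_one h𝓐 hA h01
  rw [← ae_restrict_iff' (h𝓐 A hA)]
  rcases eq_or_ne (μ A) 0 with h0 | h0
  · rw [Measure.restrict_eq_zero.2 h0]; simp
  have hm := measurable_condLExp 𝓐 μ X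
  -- Each measurable set of values has a preimage that is null or conull in A; since measurable sets
  -- separate points of [0,∞] countably, the function is constant.
  obtain ⟨c, hc⟩ : ∃ c, condLExp 𝓐 μ X =ᵐ[μ.restrict A] fun _ => c := by
    refine Filter.exists_eventuallyEq_const_of_forall_separating MeasurableSet fun U hU => ?_
    have hF : MeasurableSet[𝓐] (A ∩ condLExp 𝓐 μ X ⁻¹' U) := hA.inter (hm hU)
    rcases h01 _ hF inter_subset_left with h | h
    · right
      rw [ae_restrict_iff' (h𝓐 A hA)]
      have : ∀ᵐ x ∂μ, x ∉ A ∩ condLExp 𝓐 μ X ⁻¹' U := measure_eq_zero_iff_ae_notMem.1 h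
      filter_upwards [this] with x hx hxA hxU using hx ⟨hxA, hxU⟩
    · left
      rw [ae_restrict_iff' (h𝓐 A hA)]
      have h2 : (A ∩ condLExp 𝓐 μ X ⁻¹' U : Set Ω) =ᵐ[μ] A :=
        ae_eq_of_subset_of_measure_ge inter_subset_left h.ge (h𝓐 _ hF).nullMeasurableSet hfin.ne
      filter_upwards [h2.mem_iff] with x hx hxA using (hx.2 hxA).2
  have h1 : ∫⁻ y in A, X y ∂μ = c * μ A := by
    rw [← setLIntegral_condLExp h𝓐 μ X hA, lintegral_congr_ae hc, setLIntegral_const]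
  filter_upwards [hc] with x hx
  rw [hx, h1, mul_comm c, ← mul_assoc, ENNReal.inv_mul_cancel h0 hfin.ne, one_mul]

lemma condExpC_eq_on_atom (h𝓐 : 𝓐 ≤ mΩ) [SigmaFinite (μ.trim h𝓐)]
    {A : Set Ω} (hA : MeasurableSet[𝓐] A)
    (h01 : ∀ F : Set Ω, MeasurableSet[𝓐] F → F ⊆ A → μ F = 0 ∨ μ F = μ A) {h : Ω → ℂ}
    (hh : IntegrableOn h A μ) :
    ∀ᵐ x ∂μ, x ∈ A → condExpC 𝓐 μ h x = ((μ A).toReal⁻¹ : ℝ) • ∫ y in A, h y ∂μ := by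
  have hR : ∀ g : Ω → ℝ, IntegrableOn g A μ →
      ∀ᵐ x ∂μ, x ∈ A → condExpR 𝓐 μ g x = (μ A).toReal⁻¹ * ∫ y in A, g y ∂μ := by
    intro g hg
    filter_upwards [condLExp_eq_on_atom h𝓐 hA h01 fun y => ENNReal.ofReal (g y),
      condLExp_eq_on_atom h𝓐 hA h01 fun y => ENNReal.ofReal (-g y)] with x h1 h2 hx
    rw [condExpR, h1 hx, h2 hx, integral_eq_lintegral_pos_part_sub_lintegral_neg_part hg,
      ENNReal.toReal_mul, ENNReal.toReal_mul, ENNReal.toReal_inv]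
    ring
  filter_upwards [hR _ hh.re, hR _ hh.im] with x h1 h2 hx
  refine Complex.ext ?_ ?_
  · have := Complex.reCLM.integral_comp_comm hh
    simp only [Complex.reCLM_apply] at this
    rw [Complex.smul_re, ← this, smul_eq_mul]
    exact h1 hx
  · have := Complex.imCLM.integral_comp_comm hh
    simp only [Complex.imCLM_apply] at this
    rw [Complex.smul_im, ← this, smul_eq_mul]
    exact h2 hx

end ConditionalExpectationLemmas

/-! ### Orlicz spaces: completeness and boundedness of operators -/

section OrliczLemmas

variable {Ω : Type*} {mΩ : MeasurableSpace Ω} {μ : Measure Ω} (Φ : YoungFunction)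

lemma lintegral_le_one_of_luxemburgNorm_lt {f : Ω → ℂ} (hf : MemOrlicz Φ f μ) {k : ℝ}
    (hk : luxemburgNorm Φ f μ < k) : 0 < k ∧ ∫⁻ x, Φ (‖f x‖ / k) ∂μ ≤ 1 := by
  obtain ⟨l, hl, hlk⟩ := exists_lt_of_csInf_lt (luxemburg_set_nonempty Φ hf) hk
  exact luxemburg_set_upward Φ hlk.le hl

lemma luxemburgNorm_le {f : Ω → ℂ} {k : ℝ} (hk : 0 < k ∧ ∫⁻ x, Φ (‖f x‖ / k) ∂μ ≤ 1) :
    luxemburgNorm Φ f μ ≤ k :=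
  csInf_le ⟨0, fun _ h => h.1.le⟩ hk

lemma lintegral_div_le_one {f : Ω → ℂ} {c : ℝ} (hc : 1 ≤ c)
    (h : ∫⁻ x, Φ ‖f x‖ ∂μ ≤ ENNReal.ofReal c) : 0 < c ∧ ∫⁻ x, Φ (‖f x‖ / c) ∂μ ≤ 1 := by
  have hc0 : 0 < c := one_pos.trans_le hc
  refine ⟨hc0, ?_⟩
  calc ∫⁻ x, Φ (‖f x‖ / c) ∂μ ≤ ∫⁻ x, ENNReal.ofReal c⁻¹ * Φ ‖f x‖ ∂μ := by
        refine lintegral_mono fun x => ?_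
        rw [div_eq_inv_mul]
        exact Φ.mul_le _ (by positivity) (inv_le_one_of_one_le₀ hc)
    _ = ENNReal.ofReal c⁻¹ * ∫⁻ x, Φ ‖f x‖ ∂μ := lintegral_const_mul' _ _ ENNReal.ofReal_ne_top
    _ ≤ ENNReal.ofReal c⁻¹ * ENNReal.ofReal c := by gcongr
    _ = 1 := by
        rw [← ENNReal.ofReal_mul (by positivity), inv_mul_cancel₀ hc0.ne', ENNReal.ofReal_one]

lemma luxemburg_set_sum {f : ℕ → Ω → ℂ} (hf : ∀ n, AEStronglyMeasurable (f n) μ) {K : ℕ → ℝ}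
    (h : ∀ n, 0 < K n ∧ ∫⁻ x, Φ (‖f n x‖ / K n) ∂μ ≤ 1) (n : ℕ) :
    0 < ∑ i ∈ Finset.range (n + 1), K i ∧
      ∫⁻ x, Φ ((∑ i ∈ Finset.range (n + 1), ‖f i x‖) / ∑ i ∈ Finset.range (n + 1), K i) ∂μ ≤ 1 := by
  -- Sums of moduli are treated as complex functions so that the two-term inequality
  -- `luxemburg_set_add` applies to them.
  have hnorm : ∀ (m : ℕ) (x : Ω), ‖((∑ i ∈ Finset.range m, ‖f i x‖ : ℝ) : ℂ)‖ =
      ∑ i ∈ Finset.range m, ‖f i x‖ := fun m x => by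
    rw [Complex.norm_real, Real.norm_of_nonneg (Finset.sum_nonneg fun i _ => norm_nonneg _)]
  induction n with
  | zero => simpa using h 0
  | succ n ih =>
    have hm : AEStronglyMeasurable
        (fun x => ((∑ i ∈ Finset.range (n + 1), ‖f i x‖ : ℝ) : ℂ)) μ :=
      Complex.continuous_ofReal.comp_aestronglyMeasurable
        (Finset.aestronglyMeasurable_fun_sum _ fun i _ => (hf i).norm)
    have h1 := luxemburg_set_add Φ (f := fun x => ((∑ i ∈ Finset.range (n + 1), ‖f i x‖ : ℝ) : ℂ))
      (g := fun x => ((‖f (n + 1) x‖ : ℝ) : ℂ)) hm (k := ∑ i ∈ Finset.range (n + 1), K i)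
      (l := K (n + 1)) (by simpa only [hnorm] using ih)
      (by simpa only [Complex.norm_real, norm_norm] using h (n + 1))
    simp only [← Complex.ofReal_add, ← Finset.sum_range_succ] at h1
    simpa only [hnorm] using h1

/-- Countable subadditivity of the Luxemburg norm, in integral form. -/
lemma lintegral_tsum_le_one {f : ℕ → Ω → ℂ} (hf : ∀ n, AEStronglyMeasurable (f n) μ) {K : ℕ → ℝ}
    (hK : Summable K) (h : ∀ n, 0 < K n ∧ ∫⁻ x, Φ (‖f n x‖ / K n) ∂μ ≤ 1) :
    (∀ᵐ x ∂μ, Summable fun n => ‖f n x‖) ∧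
      ∫⁻ x, Φ ((∑' n, ‖f n x‖) / ∑' n, K n) ∂μ ≤ 1 := by
  set k := ∑' n, K n with hk
  have hk0 : 0 < k := hK.tsum_pos (fun n => (h n).1.le) 0 (h 0).1
  set S : ℕ → Ω → ℝ := fun n x => ∑ i ∈ Finset.range (n + 1), ‖f i x‖ with hS
  have hS0 : ∀ n x, 0 ≤ S n x := fun n x => Finset.sum_nonneg fun i _ => norm_nonneg _
  have hSm : ∀ x, Monotone fun n => S n x := fun x m n hmn =>
    Finset.sum_le_sum_of_subset_of_nonneg (Finset.range_mono (by lia)) fun i _ _ => norm_nonneg _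
  have hmono : ∀ x, Monotone fun n => Φ (S n x / k) := fun x m n hmn =>
    Φ.mono (div_nonneg (hS0 _ _) hk0.le) (div_le_div_of_nonneg_right (hSm x hmn) hk0.le)
  have hmeas : ∀ n, AEMeasurable (fun x => Φ (S n x / k)) μ := fun n =>
    Φ.measurable.comp_aemeasurable
      ((Finset.aemeasurable_fun_sum _ fun i _ => (hf i).norm.aemeasurable).div_const k)
  have hle : ∀ n, ∫⁻ x, Φ (S n x / k) ∂μ ≤ 1 := fun n => by
    obtain ⟨h1, h2⟩ := luxemburg_set_sum Φ hf h n
    refine (lintegral_mono fun x => Φ.mono (div_nonneg (hS0 _ _) hk0.le) ?_).trans h2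
    exact div_le_div_of_nonneg_left (hS0 _ _) h1
      (hK.sum_le_tsum _ fun i _ => (h i).1.le)
  have hsup : ∫⁻ x, ⨆ n, Φ (S n x / k) ∂μ ≤ 1 := by
    rw [lintegral_iSup' hmeas (ae_of_all _ hmono)]
    exact iSup_le hle
  have hfin : ∀ᵐ x ∂μ, ⨆ n, Φ (S n x / k) < ∞ :=
    ae_lt_top' (.iSup hmeas) (hsup.trans_lt ENNReal.one_lt_top).ne
  have hsum : ∀ᵐ x ∂μ, Summable fun n => ‖f n x‖ := by
    filter_upwards [hfin] with x hx
    -- A finite bound on Φ(S_n/k) bounds the partial sums themselves, because Φ is unbounded.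
    obtain ⟨r, hr0, -, -, hr, -⟩ := Φ.genInv_spec hx.ne
    refine summable_of_sum_range_le (c := r * k) (fun n => norm_nonneg _) fun n => ?_
    have h1 : S n x / k ≤ r := by
      by_contra! hlt
      exact absurd (hr _ hlt) (not_lt.2 (le_iSup (fun n => Φ (S n x / k)) n))
    refine le_trans ?_ ((div_le_iff₀ hk0).1 h1)
    exact Finset.sum_le_sum_of_subset_of_nonneg (Finset.range_mono (by lia))
      fun i _ _ => norm_nonneg _
  refine ⟨hsum, (lintegral_mono_ae ?_).trans hsup⟩
  filter_upwards [hsum] with x hx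
  have h1 : Filter.Tendsto (fun n => S n x / k) Filter.atTop (nhds ((∑' n, ‖f n x‖) / k)) :=
    ((Filter.tendsto_add_atTop_iff_nat 1).2 hx.hasSum.tendsto_sum_nat).div_const k
  -- Lower semicontinuity carries the bound over to the full sum, even if Φ jumps to ∞ at the limit.
  exact (Φ.lsc'.isClosed_preimage (⨆ n, Φ (S n x / k))).mem_of_tendsto h1
    (Filter.Eventually.of_forall fun n => le_iSup (fun n => Φ (S n x / k)) n)

variable {Φ} in
/-- The class of a function satisfying `MemOrlicz` in the Orlicz space. -/
def MemOrlicz.toOrlicz {f : Ω → ℂ} (hf : MemOrlicz Φ f μ) : OrliczSpace Φ μ :=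
  ⟨AEEqFun.mk f hf.1, hf.of_ae_eq Φ (AEEqFun.coeFn_mk f hf.1).symm⟩

variable {Φ}

lemma MemOrlicz.coeFn_toOrlicz {f : Ω → ℂ} (hf : MemOrlicz Φ f μ) :
    (hf.toOrlicz : Ω → ℂ) =ᵐ[μ] f := AEEqFun.coeFn_mk f hf.1

namespace OrliczSpace

lemma norm_def (f : OrliczSpace Φ μ) : ‖f‖ = luxemburgNorm Φ f μ := rfl

lemma memOrlicz (f : OrliczSpace Φ μ) : MemOrlicz Φ f μ := f.2

lemma coeFn_add (f g : OrliczSpace Φ μ) : (f + g : OrliczSpace Φ μ) =ᵐ[μ] (f + g : Ω → ℂ) :=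
  AEEqFun.coeFn_add f.1 g.1

lemma coeFn_sub (f g : OrliczSpace Φ μ) : (f - g : OrliczSpace Φ μ) =ᵐ[μ] (f - g : Ω → ℂ) :=
  AEEqFun.coeFn_sub f.1 g.1

lemma coeFn_smul (c : ℂ) (f : OrliczSpace Φ μ) :
    (c • f : OrliczSpace Φ μ) =ᵐ[μ] (c • f : Ω → ℂ) :=
  AEEqFun.coeFn_smul c f.1

lemma coeFn_zero : ((0 : OrliczSpace Φ μ) : Ω → ℂ) =ᵐ[μ] 0 := AEEqFun.coeFn_zero

lemma ext {f g : OrliczSpace Φ μ} (h : (f : Ω → ℂ) =ᵐ[μ] g) : f = g :=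
  Subtype.ext (AEEqFun.ext h)

lemma coeFn_sum (u : ℕ → OrliczSpace Φ μ) (n : ℕ) :
    ((∑ i ∈ Finset.range n, u i : OrliczSpace Φ μ) : Ω → ℂ) =ᵐ[μ]
      fun x => ∑ i ∈ Finset.range n, u i x := by
  induction n with
  | zero =>
    simp only [Finset.range_zero, Finset.sum_empty]
    exact coeFn_zero
  | succ n ih =>
    rw [Finset.sum_range_succ]
    filter_upwards [coeFn_add (∑ i ∈ Finset.range n, u i) (u n), ih] with x h1 h2
    rw [h1, Pi.add_apply, h2, Finset.sum_range_succ]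

/-- A Riesz–Fischer argument: an absolutely convergent series converges almost everywhere, and the
tails are controlled by countable subadditivity. -/
instance : CompleteSpace (OrliczSpace Φ μ) := by
  refine NormedAddCommGroup.completeSpace_of_summable_imp_tendsto fun u hu => ?_
  -- The geometric term makes K n positive and strictly larger than the norm, so the modular bound
  -- holds, and it preserves summability.
  set K : ℕ → ℝ := fun n => ‖u n‖ + (1 / 2) ^ n with hKdef
  have hK : Summable K := hu.add summable_geometric_two
  have hm : ∀ n, AEStronglyMeasurable (u n : Ω → ℂ) μ := fun n => (memOrlicz (u n)).1
  have hKn : ∀ n, 0 < K n ∧ ∫⁻ x, Φ (‖u n x‖ / K n) ∂μ ≤ 1 := fun n =>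
    lintegral_le_one_of_luxemburgNorm_lt Φ (memOrlicz (u n))
      (lt_add_of_pos_right ‖u n‖ (by positivity))
  obtain ⟨hsum, -⟩ := lintegral_tsum_le_one Φ hm hK hKn
  set F : Ω → ℂ := fun x => ∑' n, u n x with hF
  have hFm : AEStronglyMeasurable F μ := by
    refine aestronglyMeasurable_of_tendsto_ae (f := fun n x => ∑ i ∈ Finset.range n, u i x)
      Filter.atTop (fun n => Finset.aestronglyMeasurable_fun_sum _ fun i _ => hm i) ?_
    filter_upwards [hsum] with x hx using hx.of_norm.hasSum.tendsto_sum_nat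
  have hrest : ∀ N, 0 < ∑' n, K (n + N) ∧
      ∫⁻ x, Φ (‖F x - ∑ i ∈ Finset.range N, u i x‖ / ∑' n, K (n + N)) ∂μ ≤ 1 := fun N => by
    have hKN := (summable_nat_add_iff N).2 hK
    have hpos : 0 < ∑' n, K (n + N) := hKN.tsum_pos (fun n => (hKn _).1.le) 0 (hKn _).1
    obtain ⟨-, h2⟩ := lintegral_tsum_le_one Φ (fun n => hm (n + N)) hKN fun n => hKn (n + N)
    refine ⟨hpos, (lintegral_mono_ae ?_).trans h2⟩
    filter_upwards [hsum] with x hx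
    refine Φ.mono (by positivity) (div_le_div_of_nonneg_right ?_ hpos.le)
    have hFx : F x = ∑ i ∈ Finset.range N, u i x + ∑' n, u (n + N) x :=
      (hx.of_norm.sum_add_tsum_nat_add N).symm
    rw [hFx, add_sub_cancel_left]
    exact norm_tsum_le_tsum_norm ((summable_nat_add_iff N).2 hx)
  have hFmem : MemOrlicz Φ F μ := memOrlicz_of_set Φ hFm (by simpa using hrest 0)
  refine ⟨hFmem.toOrlicz, ?_⟩
  rw [tendsto_iff_norm_sub_tendsto_zero]
  refine squeeze_zero (fun n => norm_nonneg _) (fun N => ?_) (tendsto_sum_nat_add K)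
  rw [norm_sub_rev, norm_def]
  have hae : ((hFmem.toOrlicz - ∑ i ∈ Finset.range N, u i : OrliczSpace Φ μ) : Ω → ℂ) =ᵐ[μ]
      fun x => F x - ∑ i ∈ Finset.range N, u i x := by
    filter_upwards [coeFn_sub hFmem.toOrlicz (∑ i ∈ Finset.range N, u i), coeFn_sum u N,
      hFmem.coeFn_toOrlicz] with x h1 h2 h3
    rw [h1, Pi.sub_apply, h2, h3]
  rw [luxemburgNorm_congr Φ hae]
  exact luxemburgNorm_le Φ (hrest N)

/-- A bounded operator on the Orlicz space from a map on functions that is linear and bounded up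
to null sets. -/
lemma exists_clm_of_bound (L : (Ω → ℂ) → Ω → ℂ) {K : ℝ} (hK : 0 ≤ K)
    (hmem : ∀ f, MemOrlicz Φ f μ → MemOrlicz Φ (L f) μ)
    (hcongr : ∀ f g : Ω → ℂ, f =ᵐ[μ] g → L f =ᵐ[μ] L g)
    (hadd : ∀ f g, MemOrlicz Φ f μ → MemOrlicz Φ g μ → L (f + g) =ᵐ[μ] L f + L g)
    (hsmul : ∀ (c : ℂ) f, MemOrlicz Φ f μ → L (c • f) =ᵐ[μ] c • L f)
    (hbound : ∀ f, MemOrlicz Φ f μ → luxemburgNorm Φ (L f) μ ≤ K * luxemburgNorm Φ f μ) :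
    ∃ T : OrliczSpace Φ μ →L[ℂ] OrliczSpace Φ μ,
      (∀ f : OrliczSpace Φ μ, (T f : Ω → ℂ) =ᵐ[μ] L f) ∧ ‖T‖ ≤ K := by
  set T₀ : OrliczSpace Φ μ → OrliczSpace Φ μ := fun f => (hmem f f.memOrlicz).toOrlicz with hT₀
  have hT : ∀ f : OrliczSpace Φ μ, (T₀ f : Ω → ℂ) =ᵐ[μ] L f := fun f =>
    (hmem f f.memOrlicz).coeFn_toOrlicz
  let T₁ : OrliczSpace Φ μ →ₗ[ℂ] OrliczSpace Φ μ :=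
    { toFun := T₀
      map_add' := fun f g => ext <| by
        filter_upwards [hT (f + g), hT f, hT g, hcongr _ _ (coeFn_add f g),
          hadd f g f.memOrlicz g.memOrlicz, coeFn_add (T₀ f) (T₀ g)] with x h1 h2 h3 h4 h5 h6
        rw [h1, h4, h5, h6, Pi.add_apply, Pi.add_apply, h2, h3]
      map_smul' := fun c f => ext <| by
        filter_upwards [hT (c • f), hT f, hcongr _ _ (coeFn_smul c f), hsmul c f f.memOrlicz,
          coeFn_smul c (T₀ f)] with x h1 h2 h3 h4 h5
        rw [h1, h3, h4, RingHom.id_apply, h5, Pi.smul_apply, Pi.smul_apply, h2] }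
  have hb : ∀ f, ‖T₁ f‖ ≤ K * ‖f‖ := fun f => by
    rw [norm_def, norm_def]
    exact (luxemburgNorm_congr Φ (hT f)).trans_le (hbound f f.memOrlicz)
  exact ⟨T₁.mkContinuous K hb, hT, T₁.mkContinuous_norm_le hK hb⟩

end OrliczSpace

/-- If multiplication by `u` maps the Orlicz space into `L¹(A)`, it does so boundedly. -/
lemma exists_bound_setLIntegral_mul {u : Ω → ℂ} {A : Set Ω}
    (h : ∀ f, MemOrlicz Φ f μ → ∫⁻ x in A, ‖u x * f x‖ₑ ∂μ < ∞) :
    ∃ M : ℝ, 0 ≤ M ∧ ∀ f : Ω → ℂ, AEStronglyMeasurable f μ → ∫⁻ x, Φ ‖f x‖ ∂μ ≤ 1 →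
      ∫⁻ x in A, ‖u x * f x‖ₑ ∂μ ≤ ENNReal.ofReal M := by
  by_contra! hcon
  -- Gliding hump: the sum of 2⁻ⁿ|f_n| lies in the Orlicz space, but its integral against |u| over A
  -- is at least 2⁻ⁿ · 4ⁿ = 2ⁿ for every n.
  choose f hfm hf1 hf using fun n : ℕ => hcon ((4 : ℝ) ^ n) (by positivity)
  set g : ℕ → Ω → ℂ := fun n x => ((1 / 2 : ℝ) ^ n : ℝ) * f n x with hg
  have hgn : ∀ n x, ‖g n x‖ = (1 / 2 : ℝ) ^ n * ‖f n x‖ := fun n x => by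
    rw [hg, norm_mul, Complex.norm_real, Real.norm_of_nonneg (by positivity)]
  obtain ⟨hsum, hint⟩ := lintegral_tsum_le_one Φ (f := g) (K := fun n => (1 / 2 : ℝ) ^ n)
    (fun n => (hfm n).const_mul _) summable_geometric_two fun n => ⟨by positivity, by
      have : ∀ x, ‖g n x‖ / (1 / 2 : ℝ) ^ n = ‖f n x‖ := fun x => by rw [hgn]; field_simp
      simpa only [this] using hf1 n⟩
  set G : Ω → ℂ := fun x => ((∑' n, ‖g n x‖ : ℝ) : ℂ) with hG
  have hGn : ∀ x, ‖G x‖ = ∑' n, ‖g n x‖ := fun x => by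
    rw [hG, Complex.norm_real, Real.norm_of_nonneg (tsum_nonneg fun n => norm_nonneg _)]
  have hGm : AEStronglyMeasurable G μ := by
    refine aestronglyMeasurable_of_tendsto_ae
      (f := fun n x => ((∑ i ∈ Finset.range n, ‖g i x‖ : ℝ) : ℂ)) Filter.atTop
      (fun n => Complex.continuous_ofReal.comp_aestronglyMeasurable
        (Finset.aestronglyMeasurable_fun_sum _ fun i _ => ((hfm i).const_mul _).norm)) ?_
    filter_upwards [hsum] with x hx
    exact (Complex.continuous_ofReal.tendsto _).comp hx.hasSum.tendsto_sum_nat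
  have hGmem : MemOrlicz Φ G μ := by
    refine memOrlicz_of_set Φ hGm (k := ∑' n, (1 / 2 : ℝ) ^ n)
      ⟨by rw [tsum_geometric_two]; norm_num, ?_⟩
    simpa only [hGn] using hint
  have hle : ∀ n : ℕ, ENNReal.ofReal (2 ^ n) ≤ ∫⁻ x in A, ‖u x * G x‖ₑ ∂μ := fun n => by
    calc ENNReal.ofReal (2 ^ n) = ENNReal.ofReal ((1 / 2) ^ n) * ENNReal.ofReal (4 ^ n) := by
          rw [← ENNReal.ofReal_mul (by positivity), ← mul_pow]; norm_num
      _ ≤ ENNReal.ofReal ((1 / 2) ^ n) * ∫⁻ x in A, ‖u x * f n x‖ₑ ∂μ := by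
          gcongr; exact (hf n).le
      _ = ∫⁻ x in A, ENNReal.ofReal ((1 / 2) ^ n) * ‖u x * f n x‖ₑ ∂μ :=
          (lintegral_const_mul' _ _ ENNReal.ofReal_ne_top).symm
      _ ≤ ∫⁻ x in A, ‖u x * G x‖ₑ ∂μ := by
          refine lintegral_mono_ae (ae_restrict_of_ae ?_)
          filter_upwards [hsum] with x hx
          rw [← ofReal_norm, ← ofReal_norm, ← ENNReal.ofReal_mul (by positivity), norm_mul,
            norm_mul, hGn]
          refine ENNReal.ofReal_le_ofReal ?_
          have h1 := hx.le_tsum n fun i _ => norm_nonneg _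
          rw [hgn] at h1
          calc (1 / 2 : ℝ) ^ n * (‖u x‖ * ‖f n x‖) = ‖u x‖ * ((1 / 2 : ℝ) ^ n * ‖f n x‖) := by ring
            _ ≤ _ := by gcongr
  have hlim : Filter.Tendsto (fun n : ℕ => ENNReal.ofReal ((2 : ℝ) ^ n)) Filter.atTop (nhds ∞) :=
    ENNReal.tendsto_ofReal_atTop.comp (tendsto_pow_atTop_atTop_of_one_lt one_lt_two)
  exact absurd (h G hGmem) (not_lt.2 (le_of_tendsto' hlim hle))

end OrliczLemmas

/-! ### Sufficiency: small norm off the level set, finite rank on atoms -/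

section Sufficiency

variable {Ω : Type*} {𝓐 mΩ : MeasurableSpace Ω} {μ : Measure[mΩ] Ω} {Φ : YoungFunction}
  {u : Ω → ℂ}

lemma MemOrlicz.aemeasurable {Θ : ℝ → ℝ≥0∞} {f : Ω → ℂ} (hf : MemOrlicz Θ f μ) :
    AEMeasurable f μ := hf.1.aemeasurable

lemma condExpC_congr_ae {f g : Ω → ℂ} (h : f =ᵐ[μ] g) :
    condExpC 𝓐 μ f =ᵐ[μ] condExpC 𝓐 μ g := by
  have hk : ∀ F : ℂ → ℝ, condLExp 𝓐 μ (fun y => ENNReal.ofReal (F (f y))) =ᵐ[μ]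
      condLExp 𝓐 μ (fun y => ENNReal.ofReal (F (g y))) := fun F =>
    condLExp_congr_ae (h.mono fun x hx => by simp only [hx])
  filter_upwards [hk fun z => z.re, hk fun z => -z.re, hk fun z => z.im, hk fun z => -z.im]
    with x h1 h2 h3 h4
  simp only [condExpC, h1, h2, h3, h4]

lemma EM_congr_ae {f g : Ω → ℂ} (h : f =ᵐ[μ] g) : EM 𝓐 μ u f =ᵐ[μ] EM 𝓐 μ u g :=
  condExpC_congr_ae (h.mono fun x hx => by simp only [hx])

lemma EM_add (hu : AEStronglyMeasurable u μ) (hT : EMWellDefined 𝓐 μ Φ u) {f g : Ω → ℂ}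
    (hf : MemOrlicz Φ f μ) (hg : MemOrlicz Φ g μ) :
    EM 𝓐 μ u (f + g) =ᵐ[μ] EM 𝓐 μ u f + EM 𝓐 μ u g := by
  have h := condExpC_add (hu.aemeasurable.mul hf.aemeasurable) (hu.aemeasurable.mul hg.aemeasurable)
    (hT f hf) (hT g hg)
  have h1 : (fun x => u x * (f + g) x) = fun x => (u * f) x + (u * g) x := by
    ext x; simp [mul_add]
  rw [EM, h1]
  exact h

lemma EM_smul (hu : AEStronglyMeasurable u μ) (hT : EMWellDefined 𝓐 μ Φ u) {f : Ω → ℂ}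
    (hf : MemOrlicz Φ f μ) (c : ℂ) : EM 𝓐 μ u (c • f) =ᵐ[μ] c • EM 𝓐 μ u f := by
  have h := condExpC_const_mul (hu.aemeasurable.mul hf.aemeasurable) c (hT f hf)
  have h1 : (fun x => u x * (c • f) x) = fun x => c * (u * f) x := by
    ext x; simp only [Pi.smul_apply, smul_eq_mul, Pi.mul_apply]; ring
  rw [EM, h1]
  exact h

lemma aestronglyMeasurable_EM (h𝓐 : 𝓐 ≤ mΩ) (f : Ω → ℂ) :
    AEStronglyMeasurable (EM 𝓐 μ u f) μ :=
  ((measurable_condExpC _).mono h𝓐 le_rfl).aestronglyMeasurable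

lemma measurableSet_levelSet (Ψ : ℝ → ℝ≥0∞) (ε : ℝ) :
    MeasurableSet[𝓐] (levelSet 𝓐 μ Ψ u ε) :=
  ((measurable_genInv Ψ).comp (measurable_condLExp 𝓐 μ _)) measurableSet_Ici

/-- Since u itself need not lie in L^Ψ, the Hölder inequality is applied to truncations of u to
𝓐-sets of finite measure on which E Ψ(|u|) is bounded. Locality transfers the estimate back to u. -/
lemma condLExp_mul_le_off_levelSet (h𝓐 : 𝓐 ≤ mΩ) [SigmaFinite (μ.trim h𝓐)]
    (hu : AEStronglyMeasurable u μ) {C : ℝ≥0}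
    (hC : ∀ f g : Ω → ℂ, MemOrlicz Φ f μ → MemOrlicz Φ.complementary g μ →
      ∀ᵐ x ∂μ, condLExp 𝓐 μ (fun y => ‖f y * g y‖ₑ) x ≤
        C * genInv Φ (condLExp 𝓐 μ (fun y => Φ ‖f y‖) x) *
          genInv Φ.complementary (condLExp 𝓐 μ (fun y => Φ.complementary ‖g y‖) x))
    {ε : ℝ} {f : Ω → ℂ} (hf : MemOrlicz Φ f μ) :
    ∀ᵐ x ∂μ, x ∉ levelSet 𝓐 μ Φ.complementary u ε →
      condLExp 𝓐 μ (fun y => ‖u y * f y‖ₑ) x ≤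
        C * genInv Φ (condLExp 𝓐 μ (fun y => Φ ‖f y‖) x) * ENNReal.ofReal ε := by
  set Ψ := Φ.complementary with hΨ
  set P := condLExp 𝓐 μ (fun y => Ψ ‖u y‖) with hP
  have hPm : Measurable[𝓐] P := measurable_condLExp 𝓐 μ _
  have hΨu : AEMeasurable (fun y => Ψ ‖u y‖) μ :=
    Φ.measurable_complementary.comp_aemeasurable hu.norm.aemeasurable
  set S := spanningSets (μ.trim h𝓐) with hS
  set B : ℕ → Set Ω := fun n => P ⁻¹' Iic (n : ℝ≥0∞) ∩ S n with hB
  have hBm : ∀ n, MeasurableSet[𝓐] (B n) := fun n =>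
    (hPm measurableSet_Iic).inter (measurableSet_spanningSets _ n)
  have hBfin : ∀ n, μ (B n) < ∞ := fun n => by
    refine (measure_mono inter_subset_right).trans_lt ?_
    rw [← trim_measurableSet_eq h𝓐 (measurableSet_spanningSets _ n)]
    exact measure_spanningSets_lt_top _ n
  have hind : ∀ n, (fun y => Ψ ‖(B n).indicator u y‖) = (B n).indicator fun y => Ψ ‖u y‖ := by
    intro n; ext y
    by_cases hy : y ∈ B n <;> simp [hy, hΨ, Φ.complementary_zero]
  have hmem : ∀ n, MemOrlicz Ψ ((B n).indicator u) μ := fun n => by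
    refine ⟨hu.indicator (h𝓐 _ (hBm n)), 1, one_pos, ?_⟩
    simp only [one_mul]
    rw [hind, lintegral_indicator (h𝓐 _ (hBm n)), ← setLIntegral_condLExp h𝓐 μ _ (hBm n)]
    calc ∫⁻ x in B n, P x ∂μ ≤ ∫⁻ _ in B n, (n : ℝ≥0∞) ∂μ :=
          setLIntegral_mono' (h𝓐 _ (hBm n)) fun x hx => hx.1
      _ = n * μ (B n) := setLIntegral_const _ _
      _ < ∞ := ENNReal.mul_lt_top (by simp) (hBfin n)
  have hn : ∀ n, ∀ᵐ x ∂μ, x ∈ B n → x ∉ levelSet 𝓐 μ Ψ u ε →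
      condLExp 𝓐 μ (fun y => ‖u y * f y‖ₑ) x ≤
        C * genInv Φ (condLExp 𝓐 μ (fun y => Φ ‖f y‖) x) * ENNReal.ofReal ε := by
    intro n
    have h1 := hC f _ hf (hmem n)
    rw [hind] at h1
    have h2 : (fun y => ‖f y * (B n).indicator u y‖ₑ) =
        (B n).indicator fun y => ‖u y * f y‖ₑ := by
      ext y
      by_cases hy : y ∈ B n <;> simp [hy, mul_comm]
    rw [h2] at h1
    filter_upwards [h1, condLExp_indicator h𝓐 (hBm n) hΨu,
      condLExp_indicator h𝓐 (hBm n) (hu.aemeasurable.mul hf.aemeasurable).enorm]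
      with x h3 h4 h5 hx hxε
    rw [indicator_of_mem hx] at h4 h5
    rw [h4] at h3
    have h6 : condLExp 𝓐 μ ((B n).indicator fun y => ‖u y * f y‖ₑ) x =
        condLExp 𝓐 μ (fun y => ‖u y * f y‖ₑ) x := h5
    rw [h6] at h3
    refine h3.trans ?_
    gcongr
    exact (not_le.1 hxε).le
  filter_upwards [ae_all_iff.2 hn] with x hx hxε
  -- Where E Ψ(|u|) = ∞ its inverse is ∞ too, so such points lie in the level set. The truncation
  -- sets therefore exhaust its complement.
  have hlt : P x ≠ ∞ := fun h => hxε (by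
    change _ ≤ genInv Ψ (P x)
    rw [h, genInv_top]
    exact le_top)
  obtain ⟨m, hm⟩ := ENNReal.exists_nat_gt hlt
  set k := max m (spanningSetsIndex (μ.trim h𝓐) x)
  refine hx k ⟨hm.le.trans (by exact_mod_cast le_max_left _ _), ?_⟩ hxε
  exact monotone_spanningSets _ (le_max_right _ _) (mem_spanningSetsIndex _ x)

/-- Applying Φ to the Hölder bound undoes Φ⁻¹, so the integrand is pointwise at most E Φ(|f|), whose
integral equals that of Φ(|f|). -/
lemma lintegral_EM_off_levelSet_le_one (h𝓐 : 𝓐 ≤ mΩ) [SigmaFinite (μ.trim h𝓐)]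
    (hu : AEStronglyMeasurable u μ) {C : ℝ≥0} (hC0 : 0 < C)
    (hC : ∀ f g : Ω → ℂ, MemOrlicz Φ f μ → MemOrlicz Φ.complementary g μ →
      ∀ᵐ x ∂μ, condLExp 𝓐 μ (fun y => ‖f y * g y‖ₑ) x ≤
        C * genInv Φ (condLExp 𝓐 μ (fun y => Φ ‖f y‖) x) *
          genInv Φ.complementary (condLExp 𝓐 μ (fun y => Φ.complementary ‖g y‖) x))
    {ε : ℝ} (hε : 0 < ε) {f : Ω → ℂ} (hf : MemOrlicz Φ f μ) (hf1 : ∫⁻ x, Φ ‖f x‖ ∂μ ≤ 1) :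
    ∫⁻ x, Φ (‖(levelSet 𝓐 μ Φ.complementary u ε)ᶜ.indicator (EM 𝓐 μ u f) x‖ / (2 * C * ε)) ∂μ
      ≤ 1 := by
  have hC0' : (0 : ℝ) < C := hC0
  refine le_trans ?_ ((lintegral_condLExp h𝓐 μ fun y => Φ ‖f y‖).trans_le hf1)
  refine lintegral_mono_ae ?_
  filter_upwards [condLExp_mul_le_off_levelSet h𝓐 hu hC (ε := ε) hf,
    enorm_condExpC_le (𝓐 := 𝓐) (μ := μ) fun y => u y * f y,
    condLExp_lt_top (mΩ := 𝓐) (hf1.trans_lt ENNReal.one_lt_top).ne] with x h1 h2 h3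
  by_cases hx : x ∈ levelSet 𝓐 μ Φ.complementary u ε
  · simp [hx, Φ.zero']
  rw [indicator_of_mem (mem_compl hx)]
  obtain ⟨r, hr0, hr, hΦr, -, -⟩ := Φ.genInv_spec h3.ne
  refine (Φ.mono (by positivity) ?_).trans hΦr
  rw [div_le_iff₀ (by positivity)]
  have h4 : ‖EM 𝓐 μ u f x‖ₑ ≤ ENNReal.ofReal (r * (2 * C * ε)) := by
    refine h2.trans ((mul_le_mul_right (h1 hx) 2).trans ?_)
    rw [hr, ← ENNReal.ofReal_coe_nnreal, ← ENNReal.ofReal_mul (by positivity),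
      ← ENNReal.ofReal_mul (by positivity), show (2 : ℝ≥0∞) = ENNReal.ofReal 2 by simp,
      ← ENNReal.ofReal_mul (by positivity)]
    exact ENNReal.ofReal_le_ofReal (le_of_eq (by ring))
  rw [← ofReal_norm] at h4
  exact (ENNReal.ofReal_le_ofReal_iff (by positivity)).1 h4

lemma exists_clm_off_levelSet (h𝓐 : 𝓐 ≤ mΩ) [SigmaFinite (μ.trim h𝓐)]
    (hu : AEStronglyMeasurable u μ) (hT : EMWellDefined 𝓐 μ Φ u) (hH : GenCondHolder 𝓐 μ Φ) :
    ∃ C : ℝ, 0 < C ∧ ∀ ε : ℝ, 0 < ε → ∃ T : OrliczSpace Φ μ →L[ℂ] OrliczSpace Φ μ,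
      (∀ f : OrliczSpace Φ μ, (T f : Ω → ℂ) =ᵐ[μ]
        (levelSet 𝓐 μ Φ.complementary u ε)ᶜ.indicator (EM 𝓐 μ u f)) ∧ ‖T‖ ≤ C * ε := by
  obtain ⟨C, hC0, hC⟩ := hH
  have hC0' : (0 : ℝ) < C := hC0
  refine ⟨2 * C, by positivity, fun ε hε => ?_⟩
  set D := (levelSet 𝓐 μ Φ.complementary u ε)ᶜ with hD
  have hDm : MeasurableSet D := (h𝓐 _ (measurableSet_levelSet _ _)).compl
  have hsm : ∀ (c : ℂ) f, MemOrlicz Φ f μ →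
      D.indicator (EM 𝓐 μ u (c • f)) =ᵐ[μ] c • D.indicator (EM 𝓐 μ u f) := fun c f hf => by
    filter_upwards [EM_smul hu hT hf c] with x hx
    by_cases hxD : x ∈ D
    · simpa [hxD] using hx
    · simp [hxD]
  -- Homogeneity: the unit-modular estimate is applied to f/k for each k above the norm of f.
  have hset : ∀ f, MemOrlicz Φ f μ → ∀ k, luxemburgNorm Φ f μ < k →
      0 < 2 * C * ε * k ∧
        ∫⁻ x, Φ (‖D.indicator (EM 𝓐 μ u f) x‖ / (2 * C * ε * k)) ∂μ ≤ 1 := by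
    intro f hf k hk
    obtain ⟨hk0, hk1⟩ := lintegral_le_one_of_luxemburgNorm_lt Φ hf hk
    refine ⟨by positivity, ?_⟩
    have hnk : ‖((k⁻¹ : ℝ) : ℂ)‖ = k⁻¹ := by
      rw [Complex.norm_real, Real.norm_of_nonneg (by positivity)]
    have h1 := lintegral_EM_off_levelSet_le_one h𝓐 hu hC0 hC hε
      (hf.const_smul Φ ((k⁻¹ : ℝ) : ℂ)) (by
        simp only [Pi.smul_apply, norm_smul, hnk, ← div_eq_inv_mul]; exact hk1)
    refine (lintegral_mono_ae ?_).trans h1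
    filter_upwards [hsm ((k⁻¹ : ℝ) : ℂ) f hf] with x hx
    rw [hx, Pi.smul_apply, norm_smul, hnk]
    refine le_of_eq (congrArg Φ.toFun ?_)
    field_simp
  have hmem : ∀ f, MemOrlicz Φ f μ → MemOrlicz Φ (D.indicator (EM 𝓐 μ u f)) μ := fun f hf =>
    memOrlicz_of_set Φ ((aestronglyMeasurable_EM h𝓐 f).indicator hDm)
      (hset f hf _ (lt_add_one _))
  refine OrliczSpace.exists_clm_of_bound (fun f => D.indicator (EM 𝓐 μ u f)) (by positivity) hmem
    (fun f g hfg => ?_) (fun f g hf hg => ?_) hsm fun f hf => ?_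
  · filter_upwards [EM_congr_ae (𝓐 := 𝓐) (u := u) hfg] with x hx
    by_cases hxD : x ∈ D <;> simp [hxD, hx]
  · filter_upwards [EM_add hu hT hf hg] with x hx
    by_cases hxD : x ∈ D
    · simpa [hxD] using hx
    · simp [hxD]
  · rw [← div_le_iff₀' (by positivity)]
    refine le_of_forall_gt_imp_ge_of_dense fun k hk => ?_
    rw [div_le_iff₀' (by positivity)]
    exact luxemburgNorm_le Φ (hset f hf k hk)

lemma memOrlicz_indicator (Φ : YoungFunction) {A : Set Ω} (hA : MeasurableSet A) (hfin : μ A < ∞) :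
    MemOrlicz Φ (A.indicator fun _ => (1 : ℂ)) μ := by
  obtain ⟨k, hk, hk'⟩ := Φ.exists_ne_top'
  refine ⟨aestronglyMeasurable_const.indicator hA, k, hk, ?_⟩
  have : (fun x => Φ (k * ‖A.indicator (fun _ => (1 : ℂ)) x‖)) = A.indicator fun _ => Φ k := by
    ext x
    by_cases hx : x ∈ A <;> simp [hx, Φ.zero']
  rw [this, lintegral_indicator hA, setLIntegral_const]
  exact ENNReal.mul_lt_top hk'.lt_top hfin

/-- On A the function E|uf| is constantly (μ A)⁻¹ ∫_A |uf|, so finiteness of E|uf| at a single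
generic point of A gives integrability. -/
lemma setLIntegral_mul_lt_top_of_atom (h𝓐 : 𝓐 ≤ mΩ) [SigmaFinite (μ.trim h𝓐)]
    (hT : EMWellDefined 𝓐 μ Φ u) {A : Set Ω} (hA : MeasurableSet[𝓐] A)
    (h01 : ∀ F : Set Ω, MeasurableSet[𝓐] F → F ⊆ A → μ F = 0 ∨ μ F = μ A)
    {f : Ω → ℂ} (hf : MemOrlicz Φ f μ) : ∫⁻ x in A, ‖u x * f x‖ₑ ∂μ < ∞ := by
  have hfin := measure_lt_top_of_zero_one h𝓐 hA h01
  rcases eq_or_ne (μ A) 0 with h0 | h0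
  · rw [Measure.restrict_eq_zero.2 h0]; simp
  have hex : ∃ᵐ x ∂μ, x ∈ A := frequently_ae_mem_iff.2 h0
  obtain ⟨x, hxA, h1, h2⟩ := (hex.and_eventually
    ((hT f hf).and (condLExp_eq_on_atom h𝓐 hA h01 fun y => ‖u y * f y‖ₑ))).exists
  rw [h2 hxA] at h1
  by_contra! htop
  rw [top_le_iff.1 htop, ENNReal.mul_top (ENNReal.inv_ne_zero.2 hfin.ne)] at h1
  exact absurd h1 (lt_irrefl _)

/-- The restricted operator is f ↦ ((μ A)⁻¹ ∫_A uf) · 1_A: a bounded functional followed by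
multiplication of a fixed vector. It factors through ℂ and is therefore compact. -/
lemma exists_compact_on_atom (h𝓐 : 𝓐 ≤ mΩ) [SigmaFinite (μ.trim h𝓐)]
    (hu : AEStronglyMeasurable u μ) (hT : EMWellDefined 𝓐 μ Φ u) {A : Set Ω}
    (hA : MeasurableSet[𝓐] A)
    (h01 : ∀ F : Set Ω, MeasurableSet[𝓐] F → F ⊆ A → μ F = 0 ∨ μ F = μ A) :
    ∃ T : OrliczSpace Φ μ →L[ℂ] OrliczSpace Φ μ,
      (∀ f : OrliczSpace Φ μ, (T f : Ω → ℂ) =ᵐ[μ] A.indicator (EM 𝓐 μ u f)) ∧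
        IsCompactOperator T := by
  have hfin := measure_lt_top_of_zero_one h𝓐 hA h01
  have hlt : ∀ f, MemOrlicz Φ f μ → ∫⁻ x in A, ‖u x * f x‖ₑ ∂μ < ∞ := fun f hf =>
    setLIntegral_mul_lt_top_of_atom h𝓐 hT hA h01 hf
  have hint : ∀ f, MemOrlicz Φ f μ → IntegrableOn (fun x => u x * f x) A μ := fun f hf =>
    ⟨(hu.mul hf.1).restrict, hlt f hf⟩
  obtain ⟨M, hM0, hM⟩ := exists_bound_setLIntegral_mul hlt
  let φ₀ : OrliczSpace Φ μ →ₗ[ℂ] ℂ :=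
    { toFun := fun f => ∫ x in A, u x * f x ∂μ
      map_add' := fun f g => by
        rw [← integral_add (hint f f.memOrlicz) (hint g g.memOrlicz)]
        refine integral_congr_ae (ae_restrict_of_ae ?_)
        filter_upwards [OrliczSpace.coeFn_add f g] with x hx
        simp only [hx, Pi.add_apply, mul_add]
      map_smul' := fun c f => by
        rw [RingHom.id_apply, smul_eq_mul, ← integral_const_mul]
        refine integral_congr_ae (ae_restrict_of_ae ?_)
        filter_upwards [OrliczSpace.coeFn_smul c f] with x hx
        simp only [hx, Pi.smul_apply, smul_eq_mul]
        ring }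
  have hb : ∀ f, ‖φ₀ f‖ ≤ M * ‖f‖ := fun f => by
    refine le_of_forall_gt_imp_ge_of_dense fun b hb => ?_
    -- The modular bound needs k strictly above the norm, so the estimate is proved for every b >
    -- M‖f‖. The case M = 0 is separate because k = b/M is unavailable.
    obtain ⟨k, hk, hkb⟩ : ∃ k, ‖f‖ < k ∧ M * k ≤ b := by
      rcases hM0.eq_or_lt with h0 | h0
      · rw [← h0, zero_mul] at hb
        exact ⟨‖f‖ + 1, lt_add_one _, by rw [← h0, zero_mul]; exact hb.le⟩
      · exact ⟨b / M, by rwa [lt_div_iff₀' h0], by rw [mul_div_cancel₀ _ h0.ne']⟩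
    obtain ⟨hk0, hk1⟩ := lintegral_le_one_of_luxemburgNorm_lt Φ f.memOrlicz hk
    have hnk : ‖((k⁻¹ : ℝ) : ℂ)‖ = k⁻¹ := by
      rw [Complex.norm_real, Real.norm_of_nonneg (by positivity)]
    have h1 := hM (((k⁻¹ : ℝ) : ℂ) • (f : Ω → ℂ)) (f.memOrlicz.1.const_smul _) (by
        simp only [Pi.smul_apply, norm_smul, hnk, ← div_eq_inv_mul]; exact hk1)
    have h2 : ∫⁻ x in A, ‖u x * f x‖ₑ ∂μ ≤ ENNReal.ofReal (M * k) := by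
      calc ∫⁻ x in A, ‖u x * f x‖ₑ ∂μ
          = ∫⁻ x in A, ENNReal.ofReal k * ‖u x * (((k⁻¹ : ℝ) : ℂ) • (f : Ω → ℂ)) x‖ₑ ∂μ := by
            refine lintegral_congr fun x => ?_
            rw [← ofReal_norm, ← ofReal_norm, ← ENNReal.ofReal_mul hk0.le, Pi.smul_apply,
              smul_eq_mul, norm_mul, norm_mul, norm_mul, hnk]
            congr 1
            field_simp
        _ = ENNReal.ofReal k * ∫⁻ x in A, ‖u x * (((k⁻¹ : ℝ) : ℂ) • (f : Ω → ℂ)) x‖ₑ ∂μ :=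
            lintegral_const_mul' _ _ ENNReal.ofReal_ne_top
        _ ≤ ENNReal.ofReal k * ENNReal.ofReal M := by gcongr
        _ = ENNReal.ofReal (M * k) := by rw [← ENNReal.ofReal_mul hk0.le, mul_comm]
    have h3 : ‖φ₀ f‖ₑ ≤ ENNReal.ofReal (M * k) := (enorm_integral_le_lintegral_enorm _).trans h2
    rw [← ofReal_norm] at h3
    exact ((ENNReal.ofReal_le_ofReal_iff (by positivity)).1 h3).trans hkb
  let φ : OrliczSpace Φ μ →L[ℂ] ℂ := φ₀.mkContinuous M hb
  set v : OrliczSpace Φ μ := (memOrlicz_indicator Φ (h𝓐 A hA) hfin).toOrlicz with hv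
  refine ⟨(ContinuousLinearMap.toSpanSingleton ℂ v).comp ((((μ A).toReal⁻¹ : ℝ) : ℂ) • φ),
    fun f => ?_, ?_⟩
  · have hval : ((ContinuousLinearMap.toSpanSingleton ℂ v).comp
        ((((μ A).toReal⁻¹ : ℝ) : ℂ) • φ)) f =
        ((((μ A).toReal⁻¹ : ℝ) : ℂ) * ∫ x in A, u x * f x ∂μ) • v := rfl
    rw [hval]
    filter_upwards [OrliczSpace.coeFn_smul
        ((((μ A).toReal⁻¹ : ℝ) : ℂ) * ∫ x in A, u x * f x ∂μ) v,
      (memOrlicz_indicator Φ (h𝓐 A hA) hfin).coeFn_toOrlicz,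
      condExpC_eq_on_atom h𝓐 hA h01 (hint f f.memOrlicz)] with x h1 h2 h3
    rw [h1, Pi.smul_apply, h2]
    by_cases hx : x ∈ A
    · rw [indicator_of_mem hx, indicator_of_mem hx, EM, h3 hx]
      simp
    · simp [hx]
  · exact (isCompactOperator_of_locallyCompactSpace_dom
      ((((μ A).toReal⁻¹ : ℝ) : ℂ) • φ)).clm_comp (ContinuousLinearMap.toSpanSingleton ℂ v)

lemma exists_compact_on_sUnion (h𝓐 : 𝓐 ≤ mΩ) [SigmaFinite (μ.trim h𝓐)]
    (hu : AEStronglyMeasurable u μ) (hT : EMWellDefined 𝓐 μ Φ u) {F : Set (Set Ω)}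
    (hF : F.Finite) (hatom : ∀ A ∈ F, IsAtomOf 𝓐 μ A) :
    ∃ T : OrliczSpace Φ μ →L[ℂ] OrliczSpace Φ μ,
      (∀ f : OrliczSpace Φ μ, (T f : Ω → ℂ) =ᵐ[μ] (⋃₀ F).indicator (EM 𝓐 μ u f)) ∧
        IsCompactOperator T := by
  induction F, hF using Set.Finite.induction_on with
  | empty =>
    refine ⟨0, fun f => ?_, isCompactOperator_zero⟩
    simp only [sUnion_empty, indicator_empty]
    exact OrliczSpace.coeFn_zero
  | @insert A F _ hFfin ih =>
    obtain ⟨T, hTf, hTc⟩ := ih fun B hB => hatom B (mem_insert_of_mem _ hB)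
    obtain ⟨hAm, -, hA⟩ := hatom A (mem_insert _ _)
    have hUm : MeasurableSet[𝓐] (⋃₀ F) :=
      MeasurableSet.sUnion hFfin.countable fun B hB => (hatom B (mem_insert_of_mem _ hB)).1
    -- The atoms may overlap, so the part already covered is removed. What remains inherits the
    -- zero-one property but may be null.
    obtain ⟨T', hTf', hTc'⟩ := exists_compact_on_atom h𝓐 hu hT (hAm.diff hUm) fun G hG hGA => by
      refine (hA G hG (hGA.trans sdiff_subset)).imp_right fun h => ?_
      exact le_antisymm (measure_mono hGA) ((measure_mono sdiff_subset).trans h.ge)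
    refine ⟨T + T', fun f => ?_, hTc.add hTc'⟩
    filter_upwards [hTf f, hTf' f, OrliczSpace.coeFn_add (T f) (T' f)] with x h1 h2 h3
    rw [_root_.add_apply, h3, Pi.add_apply, h1, h2, sUnion_insert]
    by_cases hx : x ∈ ⋃₀ F
    · rw [indicator_of_mem hx, indicator_of_notMem (fun h => h.2 hx),
        indicator_of_mem (mem_union_right A hx), add_zero]
    · by_cases hxA : x ∈ A
      · rw [indicator_of_notMem hx, indicator_of_mem (show x ∈ A \ ⋃₀ F from ⟨hxA, hx⟩),
          indicator_of_mem (mem_union_left (⋃₀ F) hxA),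
          zero_add]
      · rw [indicator_of_notMem hx, indicator_of_notMem (fun h => hxA h.1),
          indicator_of_notMem (fun h => h.elim hxA hx), zero_add]

theorem EMCompact_of_finitelyManyAtoms (h𝓐 : 𝓐 ≤ mΩ) [SigmaFinite (μ.trim h𝓐)]
    (hu : AEStronglyMeasurable u μ) (hT : EMWellDefined 𝓐 μ Φ u) (hH : GenCondHolder 𝓐 μ Φ)
    (h : ∀ ε : ℝ, 0 < ε → FinitelyManyAtoms 𝓐 μ (levelSet 𝓐 μ Φ.complementary u ε)) :
    EMCompact 𝓐 μ Φ u := by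
  obtain ⟨C, hC0, hC⟩ := exists_clm_off_levelSet h𝓐 hu hT hH
  have hon : ∀ ε : ℝ, 0 < ε → ∃ T : OrliczSpace Φ μ →L[ℂ] OrliczSpace Φ μ,
      (∀ f : OrliczSpace Φ μ, (T f : Ω → ℂ) =ᵐ[μ]
        (levelSet 𝓐 μ Φ.complementary u ε).indicator (EM 𝓐 μ u f)) ∧ IsCompactOperator T := by
    intro ε hε
    obtain ⟨F, hF, hatom, hS⟩ := h ε hε
    obtain ⟨T, hTf, hTc⟩ := exists_compact_on_sUnion (Φ := Φ) h𝓐 hu hT hF hatom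
    exact ⟨T, fun f => (hTf f).trans (indicator_ae_eq_of_ae_eq_set hS).symm, hTc⟩
  have hsum : ∀ (T T' : OrliczSpace Φ μ →L[ℂ] OrliczSpace Φ μ) (D : Set Ω),
      (∀ f : OrliczSpace Φ μ, (T f : Ω → ℂ) =ᵐ[μ] D.indicator (EM 𝓐 μ u f)) →
      (∀ f : OrliczSpace Φ μ, (T' f : Ω → ℂ) =ᵐ[μ] Dᶜ.indicator (EM 𝓐 μ u f)) →
      ∀ f : OrliczSpace Φ μ, ((T + T') f : OrliczSpace Φ μ) =ᵐ[μ] EM 𝓐 μ u f := by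
    intro T T' D h1 h2 f
    filter_upwards [h1 f, h2 f, OrliczSpace.coeFn_add (T f) (T' f)] with x h3 h4 h5
    rw [_root_.add_apply, h5, Pi.add_apply, h3, h4, indicator_self_add_compl_apply]
  -- Any ε would do here: adding the two parts produces the bounded operator representing EM_u.
  obtain ⟨T₁, hT₁, -⟩ := hon 1 one_pos
  obtain ⟨T₂, hT₂, -⟩ := hC 1 one_pos
  have hTf := hsum T₁ T₂ _ hT₁ hT₂
  refine ⟨T₁ + T₂, hTf, ?_⟩
  choose R hR hRc using fun n : ℕ => hon (1 / ((n : ℝ) + 1)) Nat.one_div_pos_of_nat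
  choose Q hQ hQn using fun n : ℕ => hC (1 / ((n : ℝ) + 1)) Nat.one_div_pos_of_nat
  refine isCompactOperator_of_tendsto (l := Filter.atTop) (F := R) ?_
    (Filter.Eventually.of_forall hRc)
  rw [tendsto_iff_norm_sub_tendsto_zero]
  refine squeeze_zero (fun n => norm_nonneg _) (fun n => ?_)
    (mul_zero C ▸ (tendsto_one_div_add_atTop_nhds_zero_nat (𝕜 := ℝ)).const_mul C)
  -- Every splitting represents the same operator, so the error of R n is exactly the part off the
  -- level set.
  have heq : R n + Q n = T₁ + T₂ := ContinuousLinearMap.ext fun f =>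
    OrliczSpace.ext ((hsum _ _ _ (hR n) (hQ n) f).trans (hTf f).symm)
  rw [← heq, sub_add_cancel_left, norm_neg]
  exact hQn n

end Sufficiency

/-! ### Necessity: disjoint test functions with separated images -/

section Necessity

variable {Ω : Type*} {𝓐 mΩ : MeasurableSpace Ω} {μ : Measure[mΩ] Ω} {Φ : YoungFunction}
  {u : Ω → ℂ}

lemma FinitelyManyAtoms.of_null {S : Set Ω} (h : μ S = 0) : FinitelyManyAtoms 𝓐 μ S :=
  ⟨∅, finite_empty, by simp, by rw [sUnion_empty]; exact ae_eq_empty.2 h⟩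

lemma FinitelyManyAtoms.union {S T : Set Ω} (hS : FinitelyManyAtoms 𝓐 μ S)
    (hT : FinitelyManyAtoms 𝓐 μ T) : FinitelyManyAtoms 𝓐 μ (S ∪ T) := by
  obtain ⟨F, hF, hFa, hFS⟩ := hS
  obtain ⟨G, hG, hGa, hGT⟩ := hT
  refine ⟨F ∪ G, hF.union hG, fun A hA => hA.elim (hFa A) (hGa A), ?_⟩
  rw [sUnion_union]
  exact hFS.union hGT

lemma IsAtomOf.finitelyManyAtoms {A : Set Ω} (hA : IsAtomOf 𝓐 μ A) : FinitelyManyAtoms 𝓐 μ A :=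
  ⟨{A}, finite_singleton A, by simpa using hA, by
    rw [sUnion_singleton]; exact .rfl⟩

/-- B is not an atom, so it splits into two non-null 𝓐-sets. They cannot both be finite unions of
atoms; a bad one is kept and the other is discarded. -/
lemma exists_subset_not_finitelyManyAtoms {B : Set Ω} (hB : MeasurableSet[𝓐] B)
    (hbad : ¬ FinitelyManyAtoms 𝓐 μ B) : ∃ B' : Set Ω, B' ⊆ B ∧ MeasurableSet[𝓐] B' ∧
      ¬ FinitelyManyAtoms 𝓐 μ B' ∧ μ (B \ B') ≠ 0 := by
  have h0 : μ B ≠ 0 := fun h => hbad (.of_null h)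
  obtain ⟨F, hF, hFB, hF0, hFne⟩ : ∃ F : Set Ω, MeasurableSet[𝓐] F ∧ F ⊆ B ∧ μ F ≠ 0 ∧
      μ F ≠ μ B := by
    by_contra! hcon
    refine hbad (IsAtomOf.finitelyManyAtoms ⟨hB, pos_iff_ne_zero.2 h0, fun F hF hFB => ?_⟩)
    by_contra! h
    exact h.2 (hcon F hF hFB h.1)
  have hdiff : μ (B \ F) ≠ 0 := fun h =>
    hFne (measure_eq_measure_of_null_sdiff hFB h)
  by_cases hFbad : FinitelyManyAtoms 𝓐 μ F
  · refine ⟨B \ F, sdiff_subset, hB.diff hF, fun h => hbad ?_, ?_⟩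
    · rw [← union_sdiff_cancel hFB]; exact hFbad.union h
    · rwa [sdiff_sdiff_cancel_left hFB]
  · exact ⟨F, hFB, hF, hFbad, hdiff⟩

/-- Iterating the splitting gives a decreasing sequence; the discarded pieces are disjoint and
non-null. -/
lemma exists_disjoint_seq_of_not_finitelyManyAtoms {S : Set Ω} (hS : MeasurableSet[𝓐] S)
    (hbad : ¬ FinitelyManyAtoms 𝓐 μ S) : ∃ D : ℕ → Set Ω, (∀ n, MeasurableSet[𝓐] (D n)) ∧
      (∀ n, D n ⊆ S) ∧ (∀ n, μ (D n) ≠ 0) ∧ ∀ m n, m ≠ n → Disjoint (D m) (D n) := by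
  choose next hsub hmeas hnbad hpos using
    fun B : {B : Set Ω // MeasurableSet[𝓐] B ∧ ¬ FinitelyManyAtoms 𝓐 μ B} =>
      exists_subset_not_finitelyManyAtoms B.2.1 B.2.2
  let step : {B : Set Ω // MeasurableSet[𝓐] B ∧ ¬ FinitelyManyAtoms 𝓐 μ B} →
      {B : Set Ω // MeasurableSet[𝓐] B ∧ ¬ FinitelyManyAtoms 𝓐 μ B} :=
    fun B => ⟨next B, hmeas B, hnbad B⟩
  set seq : ℕ → {B : Set Ω // MeasurableSet[𝓐] B ∧ ¬ FinitelyManyAtoms 𝓐 μ B} :=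
    fun n => step^[n] ⟨S, hS, hbad⟩ with hseq
  have hsucc : ∀ n, (seq (n + 1)).1 = next (seq n) := fun n => by
    simp only [hseq, Function.iterate_succ_apply']; rfl
  have hanti : Antitone fun n => (seq n).1 :=
    antitone_nat_of_succ_le fun n => by rw [hsucc]; exact hsub _
  refine ⟨fun n => (seq n).1 \ (seq (n + 1)).1, fun n => (seq n).2.1.diff (seq (n + 1)).2.1,
    fun n => sdiff_subset.trans (hanti (Nat.zero_le n)), fun n => by
      have := hpos (seq n)
      rwa [← hsucc] at this, ?_⟩
  have hlt : ∀ m n, m < n →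
      Disjoint ((seq m).1 \ (seq (m + 1)).1) ((seq n).1 \ (seq (n + 1)).1) := fun m n hmn =>
    disjoint_left.2 fun x hx hx' => hx.2 (hanti (Nat.succ_le_of_lt hmn) hx'.1)
  intro m n hmn
  rcases lt_or_gt_of_ne hmn with h | h
  · exact hlt m n h
  · exact (hlt n m h).symm

lemma exists_subset_measure_lt_top (h𝓐 : 𝓐 ≤ mΩ) [SigmaFinite (μ.trim h𝓐)] {A : Set Ω}
    (hA : MeasurableSet[𝓐] A) (h0 : μ A ≠ 0) :
    ∃ B ⊆ A, MeasurableSet[𝓐] B ∧ μ B ≠ 0 ∧ μ B < ∞ := by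
  set S := spanningSets (μ.trim h𝓐)
  have hS : ∀ n, MeasurableSet[𝓐] (S n) := fun n => measurableSet_spanningSets _ n
  obtain ⟨n, hn⟩ : ∃ n, μ (A ∩ S n) ≠ 0 := by
    by_contra! h
    refine h0 ?_
    rw [← inter_univ A, ← iUnion_spanningSets (μ.trim h𝓐), inter_iUnion]
    exact measure_iUnion_null h
  refine ⟨_, inter_subset_left, hA.inter (hS n), hn, (measure_mono inter_subset_right).trans_lt ?_⟩
  rw [← trim_measurableSet_eq h𝓐 (hS n)]
  exact measure_spanningSets_lt_top _ n

lemma exists_pos_ofReal_le {t : ℝ≥0∞} (ht : t ≠ 0) :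
    ∃ b : ℝ, 0 < b ∧ b ≤ 1 ∧ ENNReal.ofReal b ≤ t := by
  rcases eq_or_ne t ∞ with rfl | h
  · exact ⟨1, one_pos, le_rfl, le_top⟩
  · refine ⟨min t.toReal 1, lt_min (ENNReal.toReal_pos ht h) one_pos, min_le_right _ _, ?_⟩
    exact (ENNReal.ofReal_le_ofReal (min_le_left _ _)).trans ENNReal.ofReal_toReal_le

/-- From a weight `h` with `E(|u|h) ≥ δ` on `A`, a function supported in `A` whose image under
`E M_u` is large on `A`. -/
lemma exists_test_function (h𝓐 : 𝓐 ≤ mΩ) [SigmaFinite (μ.trim h𝓐)]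
    (hu : AEStronglyMeasurable u μ) (hT : EMWellDefined 𝓐 μ Φ u) {A : Set Ω}
    (hA : MeasurableSet[𝓐] A) {h : Ω → ℝ} (hm : AEMeasurable h μ) (h0 : ∀ x, 0 ≤ h x)
    {r c δ : ℝ} (hr : 0 < r) (hc : 1 ≤ c)
    (hint : ∫⁻ x in A, Φ (r * h x) ∂μ ≤ ENNReal.ofReal c)
    (hlow : ∀ᵐ x ∂μ, x ∈ A →
      ENNReal.ofReal δ ≤ condLExp 𝓐 μ (fun y => ENNReal.ofReal (‖u y‖ * h y)) x) :
    ∃ f : Ω → ℂ, MemOrlicz Φ f μ ∧ luxemburgNorm Φ f μ ≤ c ∧ (∀ x ∉ A, f x = 0) ∧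
      ∀ᵐ x ∂μ, x ∈ A → δ * r ≤ ‖EM 𝓐 μ u f x‖ := by
  -- The factor ū/|u| cancels the phase, so uf = r|u|h ≥ 0 on A. Where u = 0 the convention 0/0 = 0
  -- does no harm.
  set f : Ω → ℂ := A.indicator fun x =>
    (starRingEnd ℂ (u x) / (‖u x‖ : ℂ)) * ((r * h x : ℝ) : ℂ) with hf
  have hfm : AEStronglyMeasurable f μ := by
    refine AEStronglyMeasurable.indicator (AEMeasurable.aestronglyMeasurable ?_) (h𝓐 A hA)
    refine AEMeasurable.mul (AEMeasurable.div ?_ ?_) ?_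
    · exact Complex.continuous_conj.measurable.comp_aemeasurable hu.aemeasurable
    · exact Complex.measurable_ofReal.comp_aemeasurable hu.norm.aemeasurable
    · exact Complex.measurable_ofReal.comp_aemeasurable (hm.const_mul r)
  have hle : ∀ x, ‖f x‖ ≤ A.indicator (fun x => r * h x) x := fun x => by
    by_cases hx : x ∈ A
    · rw [hf, indicator_of_mem hx, indicator_of_mem hx, norm_mul, norm_div, RCLike.norm_conj,
        Complex.norm_real, Complex.norm_real, norm_norm,
        Real.norm_of_nonneg (mul_nonneg hr.le (h0 x))]
      exact mul_le_of_le_one_left (mul_nonneg hr.le (h0 x)) (div_self_le_one _)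
    · simp [hf, hx]
  have hmod : ∫⁻ x, Φ ‖f x‖ ∂μ ≤ ENNReal.ofReal c := by
    refine le_trans ?_ hint
    rw [← lintegral_indicator (h𝓐 A hA)]
    refine lintegral_mono fun x => (Φ.mono (norm_nonneg _) (hle x)).trans (le_of_eq ?_)
    by_cases hx : x ∈ A <;> simp [hx, Φ.zero']
  have hset := lintegral_div_le_one Φ hc hmod
  have hmem : MemOrlicz Φ f μ := memOrlicz_of_set Φ hfm hset
  refine ⟨f, hmem, luxemburgNorm_le Φ hset, fun x hx => by rw [hf, indicator_of_notMem hx], ?_⟩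
  set g : Ω → ℝ := A.indicator fun x => r * (‖u x‖ * h x) with hg
  have hg0 : ∀ x, 0 ≤ g x := fun x =>
    indicator_nonneg (fun y _ => mul_nonneg hr.le (mul_nonneg (norm_nonneg _) (h0 y))) x
  have huf : ∀ x, u x * f x = (g x : ℂ) := fun x => by
    by_cases hx : x ∈ A
    · rw [hf, hg, indicator_of_mem hx, indicator_of_mem hx]
      rcases eq_or_ne (u x) 0 with h1 | h1
      · simp [h1]
      · have h2 : (‖u x‖ : ℂ) ≠ 0 := by exact_mod_cast norm_ne_zero_iff.2 h1
        have h3 : u x * starRingEnd ℂ (u x) = (‖u x‖ : ℂ) ^ 2 := Complex.mul_conj' _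
        push_cast
        field_simp
        rw [h3]
    · simp [hf, hg, hx]
  have hgE : (fun y => ENNReal.ofReal (g y)) =
      A.indicator (ENNReal.ofReal r • fun y => ENNReal.ofReal (‖u y‖ * h y)) := by
    ext y
    by_cases hy : y ∈ A <;> simp [hg, hy, ENNReal.ofReal_mul hr.le]
  have huh : AEMeasurable (fun y => ENNReal.ofReal (‖u y‖ * h y)) μ :=
    (hu.norm.aemeasurable.mul hm).ennreal_ofReal
  have hgfin : (fun y => ‖u y * f y‖ₑ) = fun y => ENNReal.ofReal (g y) := by
    ext y
    rw [huf, ← ofReal_norm, Complex.norm_real, Real.norm_of_nonneg (hg0 y)]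
  -- Finiteness of E|uf| is essential here: otherwise `toReal` would send ∞ to 0 and destroy the
  -- lower bound.
  have hfin := hT f hmem
  rw [hgfin] at hfin
  have hEM : ∀ x, EM 𝓐 μ u f x =
      ((condLExp 𝓐 μ (fun y => ENNReal.ofReal (g y)) x).toReal : ℂ) := fun x => by
    rw [EM, funext huf, condExpC_ofReal hg0]
  filter_upwards [hfin, hlow, condLExp_indicator h𝓐 hA (huh.const_smul (ENNReal.ofReal r)),
    condLExp_smul (mΩ := 𝓐) _ huh (ENNReal.ofReal r)] with x h1 h2 h3 h4 hx
  rw [hEM, Complex.norm_real, Real.norm_of_nonneg ENNReal.toReal_nonneg,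
    ← ENNReal.ofReal_le_iff_le_toReal h1.ne, hgE, h3, indicator_of_mem hx, h4, Pi.smul_apply,
    smul_eq_mul, mul_comm δ r, ENNReal.ofReal_mul hr.le]
  gcongr
  exact h2 hx

/-- If k < δ were admissible, then δr/k > r, so Φ(δr/k) μ A > 1, while |g|/k ≥ δr/k on A keeps that
product at most 1. -/
lemma le_luxemburgNorm {g : Ω → ℂ} (hg : MemOrlicz Φ g μ) {A : Set Ω} (hA : MeasurableSet A)
    (h0 : μ A ≠ 0) (hfin : μ A < ∞) {r δ : ℝ} (hr : 0 < r) (hrA : ∀ k, r < k → (μ A)⁻¹ < Φ k)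
    (hδ : 0 < δ) (h : ∀ᵐ x ∂μ, x ∈ A → δ * r ≤ ‖g x‖) : δ ≤ luxemburgNorm Φ g μ := by
  refine le_csInf (luxemburg_set_nonempty Φ hg) fun k hk => ?_
  obtain ⟨hk0, hk1⟩ := hk
  by_contra! hlt
  have h1 : r < δ * r / k := by rw [lt_div_iff₀ hk0]; nlinarith
  have h2 : Φ (δ * r / k) * μ A ≤ 1 := by
    rw [← setLIntegral_const]
    refine le_trans ?_ ((setLIntegral_le_lintegral A _).trans hk1)
    refine setLIntegral_mono_ae' hA ?_
    filter_upwards [h] with x hx hxA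
    exact Φ.mono (by positivity) (div_le_div_of_nonneg_right (hx hxA) hk0.le)
  have h3 := (ENNReal.mul_lt_mul_iff_left h0 hfin.ne).2 (hrA _ h1)
  rw [ENNReal.inv_mul_cancel h0 hfin.ne] at h3
  exact absurd h3 (not_lt.2 h2)

/-- The Young function at the generalized inverse of `1 / μ A`. -/
lemma exists_normalizing_constant (Φ : YoungFunction) {A : Set Ω} (h0 : μ A ≠ 0)
    (hfin : μ A < ∞) : ∃ r : ℝ, 0 < r ∧ Φ r * μ A ≤ 1 ∧ ∀ k, r < k → (μ A)⁻¹ < Φ k := by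
  obtain ⟨r, -, -, hr1, hr2, hr3⟩ := Φ.genInv_spec (ENNReal.inv_ne_top.2 h0)
  refine ⟨r, hr3 (ENNReal.inv_pos.2 hfin.ne), ?_, hr2⟩
  calc Φ r * μ A ≤ (μ A)⁻¹ * μ A := by gcongr
    _ = 1 := ENNReal.inv_mul_cancel h0 hfin.ne

/-- On every non-null `𝓐`-subset of the level set there is, up to shrinking the subset, a bounded
function supported there whose image under `E M_u` is bounded below. -/
def HasTestFunctions (𝓐 : MeasurableSpace Ω) (μ : Measure[mΩ] Ω) (Φ : YoungFunction) (u : Ω → ℂ)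
    (ε : ℝ) : Prop :=
  ∃ c δ : ℝ, 0 < δ ∧ ∀ A : Set Ω, MeasurableSet[𝓐] A → A ⊆ levelSet 𝓐 μ Φ.complementary u ε →
    μ A ≠ 0 → ∃ B ⊆ A, MeasurableSet[𝓐] B ∧ μ B ≠ 0 ∧ μ B < ∞ ∧
      ∃ r : ℝ, 0 < r ∧ (∀ k, r < k → (μ B)⁻¹ < Φ k) ∧
        ∃ f : Ω → ℂ, MemOrlicz Φ f μ ∧ luxemburgNorm Φ f μ ≤ c ∧ (∀ x ∉ B, f x = 0) ∧
          ∀ᵐ x ∂μ, x ∈ B → δ * r ≤ ‖EM 𝓐 μ u f x‖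

/-- The weight h = 1 suffices, because the linear bound on Ψ turns the lower bound for E Ψ(|u|) into
one for E|u|. -/
lemma hasTestFunctions_of_globallyWeaker (h𝓐 : 𝓐 ≤ mΩ) [SigmaFinite (μ.trim h𝓐)]
    (hΨ : ∀ y : ℝ, Φ.complementary y = 0 ↔ y = 0)
    (hu : AEStronglyMeasurable u μ) (hT : EMWellDefined 𝓐 μ Φ u)
    (hW : GloballyWeaker Φ.complementary fun x => ENNReal.ofReal x) {ε : ℝ} (hε : 0 < ε) :
    HasTestFunctions 𝓐 μ Φ u ε := by
  obtain ⟨a, ha, hW⟩ := hW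
  have ha0 : 0 < a := by
    refine ha.lt_of_ne fun h => one_ne_zero ((hΨ 1).1 ?_)
    simpa [← h] using hW 1 zero_le_one
  -- A real τ below Ψ(ε/2) is needed because Ψ(ε/2) may be ∞; it is positive since Ψ vanishes only
  -- at 0.
  obtain ⟨τ, hτ, -, hτΨ⟩ := exists_pos_ofReal_le fun h => (half_pos hε).ne' ((hΨ (ε / 2)).1 h)
  refine ⟨1, τ / a, by positivity, fun A hA hAS hA0 => ?_⟩
  obtain ⟨B, hBA, hB, hB0, hBfin⟩ := exists_subset_measure_lt_top h𝓐 hA hA0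
  obtain ⟨r, hr0, hr1, hr2⟩ := exists_normalizing_constant Φ hB0 hBfin
  refine ⟨B, hBA, hB, hB0, hBfin, r, hr0, hr2, exists_test_function h𝓐 hu hT hB
    (h := fun _ => 1) aemeasurable_const (fun _ => zero_le_one) hr0 le_rfl ?_ ?_⟩
  · simpa using hr1
  · have hle : (fun y => Φ.complementary ‖u y‖) ≤
        ENNReal.ofReal a • fun y => ENNReal.ofReal (‖u y‖ * 1) := fun y => by
      simpa [ENNReal.ofReal_mul ha] using hW ‖u y‖ (norm_nonneg _)
    have hm : AEMeasurable (fun y => ENNReal.ofReal (‖u y‖ * 1)) μ :=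
      (hu.norm.aemeasurable.mul_const 1).ennreal_ofReal
    filter_upwards [condLExp_mono (mΩ := 𝓐) (ae_of_all μ hle),
      condLExp_smul (mΩ := 𝓐) _ hm (ENNReal.ofReal a)] with x h1 h2 hx
    have h3 := hτΨ.trans ((Φ.complementary_half_le hε (hAS (hBA hx))).trans (h1.trans h2.le))
    rw [Pi.smul_apply, smul_eq_mul] at h3
    rw [ENNReal.ofReal_div_of_pos ha0]
    exact ENNReal.div_le_of_le_mul' h3

/-- The weight is h = s(|u|)/(1 + J), with s a selection satisfying Ψ_N(y) + Φ(s(y)) ≤ y s(y) and J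
= E Φ(s(|u|)). Then E(|u|h) ≥ (E Ψ_N(|u|) + J)/(1 + J), while Φ(rh) ≤ cΦ(r)Φ(s(|u|))/(1 + J) has
integral at most cΦ(r) μ B ≤ c over B. -/
lemma hasTestFunctions_of_deltaPrime (h𝓐 : 𝓐 ≤ mΩ) [SigmaFinite (μ.trim h𝓐)]
    (hΨ : ∀ y : ℝ, Φ.complementary y = 0 ↔ y = 0)
    (hu : AEStronglyMeasurable u μ) (hT : EMWellDefined 𝓐 μ Φ u)
    (hΔ : Φ.DeltaPrime) {ε : ℝ} (hε : 0 < ε) : HasTestFunctions 𝓐 μ Φ u ε := by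
  obtain ⟨c, hc0, hΔ⟩ := hΔ
  obtain ⟨b, hb, hb1, hbΨ⟩ := exists_pos_ofReal_le fun h => (half_pos hε).ne' ((hΨ (ε / 2)).1 h)
  -- The gap between τ and b leaves room to replace Ψ by a partial supremum Ψ_N. Moreover τ < b ≤ 1,
  -- as the final estimate requires.
  obtain ⟨τ, hτb, hτ⟩ : ∃ τ : ℝ, τ < b ∧ 0 < τ := ⟨b / 2, half_lt_self hb, half_pos hb⟩
  refine ⟨max c 1, τ, hτ, fun A hA hAS hA0 => ?_⟩
  obtain ⟨D, hDA, hD, hD0, hDfin⟩ := exists_subset_measure_lt_top h𝓐 hA hA0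
  have hnorm := hu.norm.aemeasurable
  have hApprox : ∀ n, AEMeasurable (fun x => Φ.complementaryApprox n ‖u x‖) (μ.restrict D) :=
    fun n => ((Φ.measurable_complementaryApprox n).comp_aemeasurable hnorm).restrict
  obtain ⟨N, hN⟩ : ∃ N, ENNReal.ofReal τ * μ D <
      ∫⁻ x in D, Φ.complementaryApprox N ‖u x‖ ∂μ := by
    refine lt_iSup_iff.1 ?_
    rw [← lintegral_iSup' hApprox (ae_of_all _ fun x => Φ.complementaryApprox_mono ‖u x‖)]
    simp only [Φ.iSup_complementaryApprox]
    rw [← setLIntegral_condLExp h𝓐 μ _ hD]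
    calc ENNReal.ofReal τ * μ D < ENNReal.ofReal b * μ D :=
          (ENNReal.mul_lt_mul_iff_left hD0 hDfin.ne).2 ((ENNReal.ofReal_lt_ofReal_iff hb).2 hτb)
      _ = ∫⁻ _ in D, ENNReal.ofReal b ∂μ := (setLIntegral_const _ _).symm
      _ ≤ _ := setLIntegral_mono' (h𝓐 D hD) fun x hx =>
          hbΨ.trans (Φ.complementary_half_le hε (hAS (hDA hx)))
  set P := condLExp 𝓐 μ (fun y => Φ.complementaryApprox N ‖u y‖) with hP
  have hPm : Measurable[𝓐] P := measurable_condLExp 𝓐 μ _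
  -- The choice of N gives only an integral lower bound over D. Shrinking to B makes it pointwise,
  -- and B is non-null since otherwise the integral would be too small.
  set B : Set Ω := D ∩ P ⁻¹' Ici (ENNReal.ofReal τ) with hBdef
  have hB : MeasurableSet[𝓐] B := hD.inter (hPm measurableSet_Ici)
  have hB0 : μ B ≠ 0 := by
    intro h
    rw [← setLIntegral_condLExp h𝓐 μ _ hD] at hN
    refine absurd hN (not_lt.2 ?_)
    rw [← setLIntegral_const]
    refine setLIntegral_mono_ae' (h𝓐 D hD) ?_
    filter_upwards [measure_eq_zero_iff_ae_notMem.1 h] with x hx hxD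
    exact (not_le.1 fun h' => hx ⟨hxD, h'⟩).le
  have hBfin : μ B < ∞ := (measure_mono inter_subset_left).trans_lt hDfin
  obtain ⟨r, hr0, hr1, hr2⟩ := exists_normalizing_constant Φ hB0 hBfin
  obtain ⟨s, M, hsm, hM, hs⟩ := Φ.exists_young_selection N
  have hΦs : AEMeasurable (fun y => Φ (s ‖u y‖)) μ :=
    (Φ.measurable.comp hsm).comp_aemeasurable hnorm
  have hus : AEMeasurable (fun y => ENNReal.ofReal (‖u y‖ * s ‖u y‖)) μ :=
    (hnorm.mul (hsm.comp_aemeasurable hnorm)).ennreal_ofReal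
  set Q := condLExp 𝓐 μ (fun y => Φ (s ‖u y‖)) with hQ
  -- This is why the selection is required to keep Φ(s) bounded; s for the full Ψ need not have that
  -- property.
  have hQfin : ∀ᵐ x ∂μ, Q x ≠ ∞ := by
    have h1 : condLExp 𝓐 μ (fun _ => M) = fun _ => M := condLExp_const h𝓐 μ M
    filter_upwards [condLExp_mono (mΩ := 𝓐) (P := μ) (X := fun y => Φ (s ‖u y‖)) (Y := fun _ => M)
      (ae_of_all μ fun y => (hs ‖u y‖ (norm_nonneg _)).2.1)] with x hx
    rw [h1] at hx
    exact (hx.trans_lt hM.lt_top).ne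
  set J : Ω → ℝ := fun x => (Q x).toReal with hJ
  have hJ0 : ∀ x, 0 ≤ J x := fun x => ENNReal.toReal_nonneg
  have hJm : Measurable[𝓐] J := (measurable_condLExp 𝓐 μ _).ennreal_toReal
  set w : Ω → ℝ≥0∞ := fun x => ENNReal.ofReal (1 + J x)⁻¹ with hw
  have hwm : Measurable[𝓐] w := ((measurable_const.add hJm).inv).ennreal_ofReal
  have hwpos : ∀ x, 0 < 1 + J x := fun x => by linarith [hJ0 x]
  refine ⟨B, inter_subset_left.trans hDA, hB, hB0, hBfin, r, hr0, hr2,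
    exists_test_function h𝓐 hu hT hB (h := fun x => (1 + J x)⁻¹ * s ‖u x‖) ?_
      (fun x => mul_nonneg (inv_nonneg.2 (hwpos x).le) (hs _ (norm_nonneg _)).1)
      hr0 (le_max_right _ _) ?_ ?_⟩
  · exact ((measurable_const.add (hJm.mono h𝓐 le_rfl)).inv).aemeasurable.mul
      (hsm.comp_aemeasurable hnorm)
  · have h1 : ∀ x, Φ (r * ((1 + J x)⁻¹ * s ‖u x‖)) ≤
        (c * Φ r) * (w x * Φ (s ‖u x‖)) := fun x => by
      have h2 := (hs ‖u x‖ (norm_nonneg _)).1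
      refine (hΔ r _ hr0.le (mul_nonneg (inv_nonneg.2 (hwpos x).le) h2)).trans ?_
      gcongr
      exact Φ.mul_le _ (inv_nonneg.2 (hwpos x).le)
        (inv_le_one_of_one_le₀ (by linarith [hJ0 x]))
    have hle : ∫⁻ x in B, w x * Φ (s ‖u x‖) ∂μ ≤ μ B := by
      rw [← setLIntegral_condLExp h𝓐 μ _ hB]
      calc ∫⁻ x in B, condLExp 𝓐 μ (fun x => w x * Φ (s ‖u x‖)) x ∂μ
          ≤ ∫⁻ _ in B, 1 ∂μ := by
            refine lintegral_mono_ae (ae_restrict_of_ae ?_)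
            filter_upwards [condLExp_mul_left h𝓐 hwm hΦs, hQfin] with x h2 h3
            rw [h2, ← hQ, ← ENNReal.ofReal_toReal h3, hw,
              ← ENNReal.ofReal_mul (inv_nonneg.2 (hwpos x).le)]
            refine ENNReal.ofReal_le_one.2 ?_
            rw [inv_mul_le_iff₀ (hwpos x)]
            change J x ≤ _
            linarith
        _ = μ B := setLIntegral_one B
    have hfin : c * Φ r ≠ ∞ := by
      refine ENNReal.mul_ne_top ENNReal.coe_ne_top fun h => ?_
      rw [h, ENNReal.top_mul hB0] at hr1
      exact absurd hr1 (by simp)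
    calc ∫⁻ x in B, Φ (r * ((1 + J x)⁻¹ * s ‖u x‖)) ∂μ
        ≤ ∫⁻ x in B, (c * Φ r) * (w x * Φ (s ‖u x‖)) ∂μ := lintegral_mono h1
      _ = (c * Φ r) * ∫⁻ x in B, w x * Φ (s ‖u x‖) ∂μ := lintegral_const_mul' _ _ hfin
      _ ≤ (c * Φ r) * μ B := by gcongr
      _ = c * (Φ r * μ B) := mul_assoc _ _ _
      _ ≤ c * 1 := by gcongr
      _ = ENNReal.ofReal c := by rw [mul_one, ENNReal.ofReal_coe_nnreal]
      _ ≤ ENNReal.ofReal (max c 1) := ENNReal.ofReal_le_ofReal (le_max_left _ _)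
  · have heq : (fun y => ENNReal.ofReal (‖u y‖ * ((1 + J y)⁻¹ * s ‖u y‖))) =
        fun y => w y * ENNReal.ofReal (‖u y‖ * s ‖u y‖) := by
      ext y
      rw [hw, ← ENNReal.ofReal_mul (inv_nonneg.2 (hwpos y).le)]
      congr 1; ring
    have hY : ((fun y => Φ.complementaryApprox N ‖u y‖) + fun y => Φ (s ‖u y‖)) ≤
        fun y => ENNReal.ofReal (‖u y‖ * s ‖u y‖) := fun y =>
      (hs ‖u y‖ (norm_nonneg _)).2.2
    rw [heq]
    filter_upwards [condLExp_mul_left h𝓐 hwm hus, condLExp_mono (mΩ := 𝓐) (ae_of_all μ hY),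
      condLExp_add_right (mΩ := 𝓐) (P := μ) (fun y => Φ.complementaryApprox N ‖u y‖) hΦs, hQfin]
      with x h1 h2 h3 h4 hx
    rw [h1]
    rw [h3, Pi.add_apply] at h2
    have hPx : ENNReal.ofReal τ ≤ P x := hx.2
    -- (τ + J)/(1 + J) ≥ τ for all J ≥ 0 because τ ≤ 1, so the bound does not depend on how large J
    -- is.
    calc ENNReal.ofReal τ ≤ ENNReal.ofReal ((1 + J x)⁻¹ * (τ + J x)) := by
          refine ENNReal.ofReal_le_ofReal ?_
          rw [le_inv_mul_iff₀ (hwpos x)]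
          nlinarith [hJ0 x]
      _ = w x * (ENNReal.ofReal τ + Q x) := by
          rw [ENNReal.ofReal_mul (inv_nonneg.2 (hwpos x).le), ENNReal.ofReal_add hτ.le (hJ0 x),
            hJ, ENNReal.ofReal_toReal h4]
      _ ≤ w x * (P x + Q x) := by gcongr
      _ ≤ _ := by gcongr

/-- The images of the test functions are δ-separated: on B m the image of f n vanishes by locality,
so the difference has norm at least δ from that set alone. A compact operator allows no such bounded
sequence. -/
lemma finitelyManyAtoms_of_EMCompact (h𝓐 : 𝓐 ≤ mΩ) [SigmaFinite (μ.trim h𝓐)]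
    (hu : AEStronglyMeasurable u μ) (hK : EMCompact 𝓐 μ Φ u) {ε : ℝ}
    (htest : HasTestFunctions 𝓐 μ Φ u ε) :
    FinitelyManyAtoms 𝓐 μ (levelSet 𝓐 μ Φ.complementary u ε) := by
  by_contra hbad
  obtain ⟨c, δ, hδ, htest⟩ := htest
  obtain ⟨T, hTf, hTc⟩ := hK
  obtain ⟨D, hDm, hDS, hD0, hDd⟩ :=
    exists_disjoint_seq_of_not_finitelyManyAtoms (measurableSet_levelSet _ _) hbad
  choose B hBD hB hB0 hBfin r hr0 hr f hf hfc hfB hlow using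
    fun n => htest (D n) (hDm n) (hDS n) (hD0 n)
  set F : ℕ → OrliczSpace Φ μ := fun n => (hf n).toOrlicz with hF
  have hFc : ∀ n, ‖F n‖ ≤ c := fun n =>
    (luxemburgNorm_congr Φ (hf n).coeFn_toOrlicz).trans_le (hfc n)
  have hsep : ∀ m n, m ≠ n → δ ≤ dist (T (F m)) (T (F n)) := by
    intro m n hmn
    rw [dist_eq_norm, OrliczSpace.norm_def]
    refine le_luxemburgNorm (T (F m) - T (F n)).memOrlicz (h𝓐 _ (hB m)) (hB0 m) (hBfin m)
      (hr0 m) (hr m) hδ ?_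
    have hzero : ∀ x ∈ B m, u x * f n x = 0 := fun x hx => by
      rw [hfB n x fun h => disjoint_left.1 (hDd m n hmn) (hBD m hx) (hBD n h), mul_zero]
    filter_upwards [OrliczSpace.coeFn_sub (T (F m)) (T (F n)), hTf (F m), hTf (F n), hlow m,
      condExpC_eq_zero h𝓐 (hu.aemeasurable.mul (hf n).aemeasurable) (hB m) hzero,
      EM_congr_ae (𝓐 := 𝓐) (u := u) (hf m).coeFn_toOrlicz,
      EM_congr_ae (𝓐 := 𝓐) (u := u) (hf n).coeFn_toOrlicz] with x h1 h2 h3 h4 h5 h6 h7 hx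
    have h8 : EM 𝓐 μ u (f n) x = 0 := h5 hx
    rw [h1, Pi.sub_apply, h2, h3, h6, h7, h8, sub_zero]
    exact h4 hx
  have hcpt := hTc.isCompact_closure_image_closedBall (f := T.toLinearMap) c
  obtain ⟨a, -, φ, hφ, hlim⟩ := hcpt.tendsto_subseq (x := fun n => T (F n)) fun n =>
    subset_closure ⟨F n, mem_closedBall_zero_iff.2 (hFc n), rfl⟩
  obtain ⟨n, hn⟩ := Metric.cauchySeq_iff.1 hlim.cauchySeq δ hδ
  exact absurd (hn n le_rfl (n + 1) n.le_succ)
    (not_lt.2 (hsep _ _ (hφ.injective.ne n.lt_succ_self.ne)))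

/-- Letting ε run through 1/(n+1) gives E Ψ(|u|) = 0 almost everywhere, so ∫ Ψ(|u|) = 0 and u itself
vanishes almost everywhere. -/
lemma EMZero_of_forall_null (h𝓐 : 𝓐 ≤ mΩ) [SigmaFinite (μ.trim h𝓐)]
    (hΨ : ∀ y : ℝ, Φ.complementary y = 0 ↔ y = 0) (hu : AEStronglyMeasurable u μ)
    (h : ∀ ε : ℝ, 0 < ε → μ (levelSet 𝓐 μ Φ.complementary u ε) = 0) : EMZero 𝓐 μ Φ u := by
  have h1 : ∀ᵐ x ∂μ, condLExp 𝓐 μ (fun y => Φ.complementary ‖u y‖) x = 0 := by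
    have h2 : ∀ n : ℕ, ∀ᵐ x ∂μ, x ∉ levelSet 𝓐 μ Φ.complementary u (1 / ((n : ℝ) + 1)) :=
      fun n => measure_eq_zero_iff_ae_notMem.1 (h _ Nat.one_div_pos_of_nat)
    filter_upwards [ae_all_iff.2 h2] with x hx
    by_contra hne
    obtain ⟨ε, hε, hle⟩ := Φ.le_genInv_complementary hne
    obtain ⟨n, hn⟩ := exists_nat_one_div_lt hε
    exact hx n ((ENNReal.ofReal_le_ofReal hn.le).trans hle)
  have h3 : ∫⁻ x, Φ.complementary ‖u x‖ ∂μ = 0 := by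
    rw [← lintegral_condLExp h𝓐 μ, lintegral_congr_ae h1, lintegral_zero]
  have h4 := (lintegral_eq_zero_iff'
    (Φ.measurable_complementary.comp_aemeasurable hu.norm.aemeasurable)).1 h3
  have h5 : u =ᵐ[μ] 0 := by
    filter_upwards [h4] with x hx
    exact norm_eq_zero.1 ((hΨ _).1 hx)
  intro f
  have h6 : EM 𝓐 μ u f =ᵐ[μ] condExpC 𝓐 μ fun _ => ((0 : ℝ) : ℂ) :=
    condExpC_congr_ae (h5.mono fun x hx => by simp [hx])
  filter_upwards [h6] with x hx
  rw [hx, condExpC_ofReal fun _ => le_rfl]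
  have h7 : condLExp 𝓐 μ (fun _ => (0 : ℝ≥0∞)) x = 0 := congrFun (condLExp_zero μ) x
  simp [h7]

end Necessity

end

theorem corollary2p4 {Ω : Type*} {mΩ : MeasurableSpace Ω} (𝓐 : MeasurableSpace Ω) (h𝓐 : 𝓐 ≤ mΩ)
    (μ : Measure[mΩ] Ω) [SigmaFinite (μ.trim h𝓐)]
    (Φ : YoungFunction) (hΨ : ∀ y : ℝ, Φ.complementary y = 0 ↔ y = 0)
    (u : Ω → ℂ) (hu : AEStronglyMeasurable[mΩ] u μ)
    (hT : EMWellDefined 𝓐 μ Φ u)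
    (hH : GenCondHolder 𝓐 μ Φ) :
    (Φ.DeltaPrime ∨ GloballyWeaker Φ.complementary (fun x => ENNReal.ofReal x) →
      (EMCompact 𝓐 μ Φ u ↔
        ∀ ε : ℝ, 0 < ε → FinitelyManyAtoms 𝓐 μ (levelSet 𝓐 μ Φ.complementary u ε))) ∧
    ((∀ A : Set Ω, ¬ IsAtomOf 𝓐 μ A) → Φ.DeltaPrime →
      (EMCompact 𝓐 μ Φ u ↔ EMZero 𝓐 μ Φ u)) := by
  refine ⟨fun hcond => ⟨fun hK ε hε => finitelyManyAtoms_of_EMCompact h𝓐 hu hK ?_,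
    EMCompact_of_finitelyManyAtoms h𝓐 hu hT hH⟩, fun hna hΔ => ⟨fun hK => ?_, fun h0 => ?_⟩⟩
  · exact hcond.elim (fun h => hasTestFunctions_of_deltaPrime h𝓐 hΨ hu hT h hε)
      fun h => hasTestFunctions_of_globallyWeaker h𝓐 hΨ hu hT h hε
  · refine EMZero_of_forall_null h𝓐 hΨ hu fun ε hε => ?_
    obtain ⟨F, -, hF, hS⟩ := finitelyManyAtoms_of_EMCompact h𝓐 hu hK
      (hasTestFunctions_of_deltaPrime h𝓐 hΨ hu hT hΔ hε)
    have : F = ∅ := eq_empty_of_forall_notMem fun A hA => hna A (hF A hA)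
    rw [measure_congr hS, this, sUnion_empty, measure_empty]
  · exact ⟨0, fun f => OrliczSpace.coeFn_zero.trans (h0 f).symm, isCompactOperator_zero⟩
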